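/- Let $d\in\{1,2\}$, $\alpha\in(d,2d)$, $\beta\in\mathbb{R}$, and let $q\ge 1$ be an integer with $$q>|\beta|\,\pi\sum_{x\in\mathbb{Z}^d\setminus\{0\}}|x|^{-\alpha},$$ where $|\cdot|$ is the Euclidean norm. *Continuous model.* Let $\mathbb{S}^1\simeq[0,2\pi)$ be the circle with Lebesgue measure $\lambda$ (total mass $2\pi$). For $S\subseteq\mathbb{Z}^d$ and $\omega\in(\mathbb{S}^1)^S$ put $\Phi_A(\omega)=|x-y|^{-\alpha}\,\omega_x\cdot\omega_y$ if $A=\{x,y\}\subseteq S$ with $x\neq y$, and $\Phi_A=0$ for every other finite $A\subseteq S$; here $\omega_x\cdot\omega_y$ is the scalar product in $\mathbb{R}^2$. For finite $\Lambda\subseteq S$ let $\mathcal{H}^S_\Lambda=\sum_{A\subseteq S\text{ finite},\,A\cap\Lambda\ne\emptyset}\Phi_A$, and let $$\gamma^S_\Lambda(B\,|\,\eta)=\frac1{Z}\int \mathbf 1_B(\zeta\,\eta_{S\setminus\Lambda})\,e^{-\beta\mathcal{H}^S_\Lambda(\zeta\,\eta_{S\setminus\Lambda})}\,\lambda^{\otimes\Lambda}(d\zeta),$$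 where $Z$ is the normalising constant. *Constrained Gibbs measures.* Let $T:\mathbb{S}^1\to\{1,\dots,q\}$ be the discretisation that maps the arc $[2\pi(k-1)/q,2\pi k/q)$ to $k$. For $\sigma\in\{1,\dots,q\}^S$ let $\gamma^{S,\sigma}_\Lambda(\cdot\,|\,\eta)$ be $\gamma^S_\Lambda(\cdot\,|\,\eta)$ conditioned on the event $\{\omega: T(\omega_x)=\sigma_x\ \text{for all } x\in\Lambda\}$. A Gibbs measure for $\gamma^{S,\sigma}$ is a probability measure $\mu$ on $(\mathbb{S}^1)^S$ such that $\int\gamma^{S,\sigma}_\Lambda(B|\eta)\,\mu(d\eta)=\mu(B)$ for all finite $\Lambda\subseteq S$ and all measurable $B$. For $S=x^c=\mathbb{Z}^d\setminus\{x\}$ let $\mu_{x^c}[\sigma]$ denote the Gibbs measure for $\gamma^{S,\sigma}$. *Rates.* For $\omega'\in\Omega'=\{1,\dots,q\}^{\mathbb{Z}^d}$ let $(\omega')^x$ be the configuration obtained from $\omega'$ by raising the label at $x$ by one modulo $q$, let $\omega'_x|^r=\sup\{\varphi\in[0,2\pi):T(\varphi)=\omega'_x\}$ be the right endpoint of the arc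 with label $\omega'_x$, and let $\mathcal{H}_x=\mathcal{H}^{\mathbb{Z}^d}_{\{x\}}$. Put $$c(\omega',(\omega')^x)=\frac{\displaystyle\int e^{-\beta\mathcal{H}_x(\omega'_x|^r,\,\omega)}\;\mu_{x^c}[\omega'_{x^c}](d\omega)}{\displaystyle\int\Big(\int_{\{\theta:\,T(\theta)=\omega'_x\}}e^{-\beta\mathcal{H}_x(\theta,\,\omega)}\,\lambda(d\theta)\Big)\mu_{x^c}[\omega'_{x^c}](d\omega)}.$$ Consider the rates $c_\Delta(\eta,\xi_\Delta)$, for finite $\Delta\subset\mathbb{Z}^d$, $\eta\in\Omega'$ and $\xi_\Delta\in\{1,\dots,q\}^\Delta$, that equal $c(\eta,\eta^x)$ if $\Delta=\{x\}$ and $\xi_\Delta\eta_{\Delta^c}=\eta^x$, and $0$ otherwise. Let $\delta_x(f)=\sup\{|f(\eta)-f(\zeta)|:\eta=\zeta\text{ off }x\}$. **Lemma.** For all $x\in\mathbb{Z}^d$ and $\sigma\in\{1,\dots,q\}^{x^c}$ there is exactly one Gibbs measure $\mu_{x^c}[\sigma]$, so the rates are well defined. They are nonnegative, continuous in $\eta$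 (for the product topology on $\Omega'$) and translation invariant, and they satisfy: - **(L1)** $\displaystyle\sum_{\Delta\ni0}\sum_{\xi_\Delta}\|c_\Delta(\cdot,\xi_\Delta)\|_\infty<\infty$; - **(L2)** $\displaystyle\sum_{\Delta\ni0}\sum_{x\ne0}\sum_{\xi_\Delta}\delta_x\big(c_\Delta(\cdot,\xi_\Delta)\big)<\infty$; - **(ND)** for every finite $\Delta\subset\mathbb{Z}^d$ and all $\eta,\xi\in\Omega'$ that agree on $\Delta^c$ there is a finite sequence $\eta=\eta^{(0)},\dots,\eta^{(n)}=\xi$ in $\Omega'$ such that the transition rate from $\eta^{(i)}$ to $\eta^{(i+1)}$ is positive for every $i<n$. -/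

import Mathlib

open MeasureTheory ProbabilityTheory
open scoped Classical ENNReal

noncomputable section

namespace RotatingIPS

/-- The lattice `ℤ^d`. -/
abbrev Site (d : ℕ) : Type := Fin d → ℤ

/-- The Euclidean length of a lattice vector. -/
def siteNorm {d : ℕ} (x : Site d) : ℝ := Real.sqrt (∑ i, (x i : ℝ) ^ 2)

instance twoPiPos : Fact ((0 : ℝ) < 2 * Real.pi) := ⟨Real.two_pi_pos⟩

/-- The continuous local state space, the circle `ℝ / 2πℤ`. Its `volume` is the Lebesgue measure
of total mass `2π`. -/
abbrev Spin : Type := AddCircle (2 * Real.pi)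

/-- The scalar product of two spins, seen as unit vectors in the plane `ℂ`. -/
def spinDot (θ φ : Spin) : ℝ :=
  inner ℝ ((AddCircle.toCircle θ : Circle) : ℂ) ((AddCircle.toCircle φ : Circle) : ℂ)

theorem spinDot_coe (a b : ℝ) : spinDot (a : Spin) (b : Spin) = Real.cos (a - b) := by
  have h : 2 * Real.pi / (2 * Real.pi) = 1 := div_self Real.two_pi_pos.ne'
  simp only [spinDot, AddCircle.toCircle_apply_mk, h, one_mul, Circle.coe_exp, Complex.inner]
  rw [← Complex.exp_conj, ← Complex.exp_add]
  simp only [map_mul, Complex.conj_I, Complex.conj_ofReal]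
  rw [show (b : ℂ) * Complex.I + a * -Complex.I = ((b - a : ℝ) : ℂ) * Complex.I by
    push_cast; ring, Complex.exp_ofReal_mul_I_re, ← Real.cos_neg, neg_sub]

/-- Continuous-spin configurations on a set `S` of sites. -/
abbrev Config {d : ℕ} (S : Set (Site d)) : Type := S → Spin

/-- Discrete-spin configurations on a set `S` of sites; the label `k : Fin q` stands for the
arc `[2πk/q, 2π(k+1)/q)`. -/
abbrev DConfig {d : ℕ} (q : ℕ) (S : Set (Site d)) : Type := S → Fin q

section Discretisation

/-- The representative in `[0, 2π)` of a point of the circle. -/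
def angle (θ : Spin) : ℝ := (AddCircle.equivIco (2 * Real.pi) 0 θ : ℝ)

theorem angle_nonneg (θ : Spin) : 0 ≤ angle θ :=
  (AddCircle.equivIco (2 * Real.pi) 0 θ).2.1

theorem angle_lt (θ : Spin) : angle θ < 2 * Real.pi :=
  (AddCircle.equivIco (2 * Real.pi) 0 θ).2.2.trans_eq (zero_add _)

theorem floor_angle_lt (q : ℕ) [NeZero q] (θ : Spin) :
    ⌊q * angle θ / (2 * Real.pi)⌋₊ < q := by
  have hq : (0 : ℝ) < q := Nat.cast_pos.mpr (NeZero.pos q)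
  rw [Nat.floor_lt (div_nonneg (mul_nonneg hq.le (angle_nonneg θ)) Real.two_pi_pos.le),
    div_lt_iff₀ Real.two_pi_pos]
  exact mul_lt_mul_of_pos_left (angle_lt θ) hq

variable (q : ℕ) [NeZero q]

/-- The discretisation map `T` of the circle into `q` arcs of equal length. -/
def coarse (θ : Spin) : Fin q := ⟨⌊q * angle θ / (2 * Real.pi)⌋₊, floor_angle_lt q θ⟩

/-- The right endpoint of the arc with label `k`. -/
def arcRight (k : Fin q) : ℝ :=
  sSup {φ : ℝ | φ ∈ Set.Ico 0 (2 * Real.pi) ∧ coarse q (φ : Spin) = k}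

end Discretisation

section Gibbs

variable {d : ℕ} (α β : ℝ) {S : Set (Site d)}

/-- The interaction potential: `Φ_A(ω) = |x - y|^(-α) ω_x · ω_y` if `A = {x, y}` has two elements,
and `0` otherwise. (The sum runs over the two orderings of the pair.) -/
def potential (A : Finset S) (ω : Config S) : ℝ :=
  if A.card = 2 then
    (1 / 2) * ∑ p ∈ A.offDiag,
      siteNorm (p.1.1 - p.2.1) ^ (-α) * spinDot (ω p.1) (ω p.2)
  else 0

/-- The Hamiltonian in the finite volume `Λ ⊆ S`, where only interactions inside `S` are kept:
the sum of `Φ_A` over all finite `A ⊆ S` that meet `Λ`. -/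
def hamiltonian (Λ : Finset S) (ω : Config S) : ℝ :=
  ∑' A : {A : Finset S // (A ∩ Λ).Nonempty}, potential α A.1 ω

/-- The configuration that is `ζ` in `Λ` and `η` outside. -/
def glue {V E : Type} (Λ : Finset V) (ζ : Λ → E) (η : V → E) : V → E :=
  fun x => if h : x ∈ Λ then ζ ⟨x, h⟩ else η x

/-- The unnormalised finite-volume Gibbs distribution with boundary condition `η`. -/
def gibbsWeight (Λ : Finset S) (η : Config S) : Measure (Config S) :=
  Measure.map (fun ζ : Λ → Spin => glue Λ ζ η)
    ((Measure.pi fun _ : Λ => (volume : Measure Spin)).withDensity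
      fun ζ => ENNReal.ofReal (Real.exp (-(β * hamiltonian α Λ (glue Λ ζ η)))))

/-- The finite-volume Gibbs distribution `γ_Λ(· | η)` on `S`. -/
def gibbsKernel (Λ : Finset S) (η : Config S) : Measure (Config S) :=
  (gibbsWeight α β Λ η Set.univ)⁻¹ • gibbsWeight α β Λ η

variable (q : ℕ) [NeZero q]

/-- The continuous configurations whose discretisation agrees with `σ` on `Λ`. -/
def cylinder (σ : DConfig q S) (Λ : Finset S) : Set (Config S) :=
  {ω | ∀ x ∈ Λ, coarse q (ω x) = σ x}

/-- The constrained finite-volume Gibbs distribution: `γ_Λ(· | η)` conditioned on the cylinder. -/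
def constrainedKernel (σ : DConfig q S) (Λ : Finset S) (η : Config S) : Measure (Config S) :=
  ProbabilityTheory.cond (gibbsKernel α β Λ η) (cylinder q σ Λ)

/-- `μ` is a Gibbs measure for the constrained specification on `S` (DLR equations). -/
def IsConstrainedGibbs (σ : DConfig q S) (μ : Measure (Config S)) : Prop :=
  IsProbabilityMeasure μ ∧
    ∀ (Λ : Finset S) (B : Set (Config S)), MeasurableSet B →
      ∫⁻ η, constrainedKernel α β q σ Λ η B ∂μ = μ B

/-- The constrained Gibbs measure `μ_S[σ]`. -/
def constrainedGibbs (σ : DConfig q S) : Measure (Config S) :=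
  if h : ∃ μ, IsConstrainedGibbs α β q σ μ then h.choose else 0

end Gibbs

section Rates

variable {d : ℕ}

/-- Insert the spin `θ` at the site `x` into a configuration on the complement of `{x}`. -/
def insertSpin (x : Site d) (θ : Spin) (ω : Config ({x}ᶜ : Set (Site d))) :
    Config (Set.univ : Set (Site d)) :=
  fun y => if h : y.1 = x then θ else ω ⟨y.1, h⟩

/-- The energy `H_x(θ, ω)` of the spin `θ` at `x` in the full lattice, given the configuration `ω`
on the complement of `{x}`. -/
def siteEnergy (α : ℝ) (x : Site d) (θ : Spin) (ω : Config ({x}ᶜ : Set (Site d))) : ℝ :=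
  hamiltonian α ({⟨x, Set.mem_univ x⟩} : Finset (Set.univ : Set (Site d))) (insertSpin x θ ω)

variable (α β : ℝ) (q : ℕ) [NeZero q]

/-- The restriction of a discrete configuration to a set of sites. -/
def restr {q : ℕ} (S : Set (Site d)) (η : Site d → Fin q) : DConfig q S := fun y => η y.1

/-- The rate `c(η, η^x)` of rotating the discrete spin at `x` by one step. -/
def rotationRate (x : Site d) (η : Site d → Fin q) : ℝ :=
  (∫ ω, Real.exp (-(β * siteEnergy α x ((arcRight q (η x) : ℝ) : Spin) ω))
      ∂(constrainedGibbs α β q (restr {x}ᶜ η))) /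
  (∫ ω, (∫ θ in {θ : Spin | coarse q θ = η x}, Real.exp (-(β * siteEnergy α x θ ω)))
      ∂(constrainedGibbs α β q (restr {x}ᶜ η)))

/-- The configuration `η^x`: the label at `x` is increased by one modulo `q`. -/
def rotate {q : ℕ} [NeZero q] (x : Site d) (η : Site d → Fin q) : Site d → Fin q :=
  Function.update η x (η x + 1)

/-- A family of transition rates `c_Δ(η, ξ_Δ)` for finite volumes `Δ`. -/
abbrev RateFamily (d q : ℕ) : Type :=
  (Δ : Finset (Site d)) → (Site d → Fin q) → (Δ → Fin q) → ℝ

/-- The rates of the rotation dynamics: the only possible jumps are `η ↦ η^x`, which take place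
in the volume `{x}` at rate `c(η, η^x)`. -/
def rotationRates : RateFamily d q := fun Δ η ξ =>
  ∑ x ∈ Δ, if Δ = {x} ∧ glue Δ ξ η = rotate x η then rotationRate α β q x η else 0

end Rates

section Criteria

variable {d q : ℕ}

/-- The oscillation at the site `x` of a function of the configuration. -/
def oscAt (x : Site d) (f : (Site d → Fin q) → ℝ) : ℝ≥0∞ :=
  ⨆ (η : Site d → Fin q) (ζ : Site d → Fin q) (_ : ∀ y, y ≠ x → η y = ζ y),
    ENNReal.ofReal |f η - f ζ|

/-- The supremum norm. -/
def supNorm (f : (Site d → Fin q) → ℝ) : ℝ≥0∞ :=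
  ⨆ η : Site d → Fin q, ENNReal.ofReal |f η|

/-- The rates are nonnegative and continuous in the starting configuration. -/
def IsContinuousRates (c : RateFamily d q) : Prop :=
  ∀ (Δ : Finset (Site d)) (ξ : Δ → Fin q), (∀ η, 0 ≤ c Δ η ξ) ∧ Continuous fun η => c Δ η ξ

/-- Translation invariance: `c_{Δ+v}(τ_v η, τ_v ζ) = c_Δ(η, ζ)`, with `(τ_v η)_y = η_{y-v}`. -/
def IsTranslationInvariant (c : RateFamily d q) : Prop :=
  ∀ (v : Site d) (Δ : Finset (Site d)) (η ζ : Site d → Fin q),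
    c (Δ.image (· + v)) (fun y => η (y - v)) (fun y => ζ (y.1 - v)) = c Δ η (fun y => ζ y.1)

/-- Bounded total rate: `∑_{Δ ∋ 0} ∑_{ξ_Δ} ‖c_Δ(·, ξ_Δ)‖_∞ < ∞`. -/
def BoundedTotalRate (c : RateFamily d q) : Prop :=
  ∑' Δ : {Δ : Finset (Site d) // (0 : Site d) ∈ Δ}, ∑ ξ : Δ.1 → Fin q,
    supNorm (fun η => c Δ.1 η ξ) < ∞

/-- Summable oscillations: `∑_{Δ ∋ 0} ∑_{x ≠ 0} ∑_{ξ_Δ} δ_x(c_Δ(·, ξ_Δ)) < ∞`. -/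
def SummableOscillations (c : RateFamily d q) : Prop :=
  ∑' Δ : {Δ : Finset (Site d) // (0 : Site d) ∈ Δ}, ∑' x : {x : Site d // x ≠ 0},
    ∑ ξ : Δ.1 → Fin q, oscAt x.1 (fun η => c Δ.1 η ξ) < ∞

/-- The transition from `η` to `ζ` has positive rate. -/
def PositiveRate (c : RateFamily d q) (η ζ : Site d → Fin q) : Prop :=
  ∃ Δ : Finset (Site d), (∀ y, y ∉ Δ → ζ y = η y) ∧ 0 < c Δ η (fun y => ζ y.1)

/-- Non-degeneracy: configurations that agree off a finite volume are connected by finitely many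
transitions of positive rate. -/
def NonDegenerate (c : RateFamily d q) : Prop :=
  ∀ (Δ : Finset (Site d)) (η ξ : Site d → Fin q), (∀ y, y ∉ Δ → η y = ξ y) →
    ∃ (n : ℕ) (path : ℕ → Site d → Fin q), path 0 = η ∧ path n = ξ ∧
      ∀ i, i < n → PositiveRate c (path i) (path (i + 1))

end Criteria

end RotatingIPS

end

set_option linter.unusedSectionVars false

/-! Each constrained Gibbs measure belongs to a spin system whose a priori measure at a site is
Lebesgue measure on one arc, and the argument is Dobrushin's method with a constant that matches the
bound on q. Moving the spin at y inside its arc changes the energy of any given spin value at x by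
at most |β| |x-y|^(-α) 2π/q, because the cosine is 1-Lipschitz. Up to an additive constant, the
log-density of the single-site law at x then changes by a function of oscillation at most twice
that. Tilting by a function of oscillation ε costs at most ε/4 in total variation
(`abs_integral_tilted_sub_le`), so the influence of y on x is at most |β| π |x-y|^(-α) / q, and the
hypothesis says that these influences have row sums below one.

Existence is compactness: the finite-volume kernels are consistent and Feller, so a limit of
finite-volume distributions satisfies the DLR equations (`IsEnergy.exists_isLocalGibbs`). Uniqueness
and the dependence on the labels come from one comparison theorem, `IsEnergy.abs_integral_sub_le`,
for two Gibbs measures whose a priori measures differ only on a set D. A change at y in D first acts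
with an influence B that need not be small, since there the spin may move on the whole circle; it
then propagates through the contraction C of spins confined to their arcs. The total effect is G = ∑
Cⁿ B. Taking D empty gives uniqueness; in general the bound is a sum over the sites of D.

A rate is a quotient of two expectations of local Boltzmann weights. These weights are bounded above
and away from zero by compactness, which gives bounded, positive rates, and their oscillations are
summable because the couplings are. The comparison theorem thus bounds the change of a rate, when
the label at its own site is kept, by a summable family restricted to the sites whose labels differ
(`exists_rotationRate_bounds`). This yields continuity and (L2). Translation invariance follows from
uniqueness, and (ND) from positivity, as repeated rotations reach every label. -/

namespace RotatingIPS

/-! ### Total variation cost of tilting a probability measure -/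

section TotalVariation

/-- Two facts combine: (s-1)/(s+1) ≤ log s / 2, and a(s-1)² - (1-a)(as²-1) = (as-1)². The worst case
a = 1/s is a density that ranges over [1/s, s]. -/
theorem one_sub_mul_sub_one_le {a s : ℝ} (ha : 0 < a) (hs : 1 < s) :
    (1 - a) * (a * s ^ 2 - 1) ≤ (a * s ^ 2 - a) * (Real.log s / 2) := by
  have hlog : 2 * (s - 1) / (s - 1 + 2) ≤ Real.log s := by
    simpa using Real.le_log_one_add_of_nonneg (sub_nonneg.2 hs.le)
  have h1 : (s - 1) / (s + 1) ≤ Real.log s / 2 := by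
    rw [show s - 1 + 2 = s + 1 by ring, mul_div_assoc] at hlog
    linarith
  have hs2 : 1 < s ^ 2 := one_lt_pow₀ hs two_ne_zero
  have h2 : 0 ≤ a * s ^ 2 - a := by nlinarith
  refine le_trans ?_ (mul_le_mul_of_nonneg_left h1 h2)
  rw [show (a * s ^ 2 - a) * ((s - 1) / (s + 1)) = a * (s - 1) ^ 2 by
    field_simp
    ring]
  nlinarith [sq_nonneg (a * s - 1)]

theorem abs_integral_mul_sub_one_le {Ω : Type*} [MeasurableSpace Ω] {p : Measure Ω}
    [IsProbabilityMeasure p] {r g : Ω → ℝ} {a s δ c : ℝ} (ha : 0 < a) (hs : 1 < s)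
    (hr : Integrable r p) (hg : AEStronglyMeasurable g p) (hr1 : ∫ x, r x ∂p = 1)
    (hra : ∀ᵐ x ∂p, a ≤ r x) (hrb : ∀ᵐ x ∂p, r x ≤ a * s ^ 2)
    (hgc : ∀ᵐ x ∂p, |g x - c| ≤ δ / 2) :
    |∫ x, g x * (r x - 1) ∂p| ≤ Real.log s / 2 * δ := by
  have hδ : 0 ≤ δ := by
    obtain ⟨x, hx⟩ := hgc.exists
    linarith [abs_nonneg (g x - c)]
  have ha1 : a ≤ 1 := by
    have := integral_mono_ae (integrable_const a) hr hra
    simpa [hr1] using this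
  have hb1 : 1 ≤ a * s ^ 2 := by
    have := integral_mono_ae hr (integrable_const (a * s ^ 2)) hrb
    simpa [hr1] using this
  have hs2 : 1 < s ^ 2 := one_lt_pow₀ hs two_ne_zero
  have hab : 0 < a * s ^ 2 - a := by nlinarith
  have hr' : Integrable (fun x => r x - 1) p := hr.sub (integrable_const 1)
  have habs : Integrable (fun x => |r x - 1|) p := hr'.abs
  -- On the interval [a, as²] the convex function |r - 1| lies below its chord, and the chord
  -- integrates explicitly because r has mean one.
  have hL1 : (∫ x, |r x - 1| ∂p) * (a * s ^ 2 - a) ≤ 2 * ((1 - a) * (a * s ^ 2 - 1)) := by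
    rw [← integral_mul_const]
    calc ∫ x, |r x - 1| * (a * s ^ 2 - a) ∂p
        ≤ ∫ x, ((a * s ^ 2 * (1 - a) - a * (a * s ^ 2 - 1)) + (a * s ^ 2 + a - 2) * r x) ∂p := by
          refine integral_mono_ae (habs.mul_const _)
            ((integrable_const _).add (hr.const_mul _)) ?_
          filter_upwards [hra, hrb] with x h1 h2
          rcases abs_cases (r x - 1) with ⟨h, _⟩ | ⟨h, _⟩ <;> simp only [h] <;> nlinarith
      _ = 2 * ((1 - a) * (a * s ^ 2 - 1)) := by
          rw [integral_add (integrable_const _) (hr.const_mul _), integral_const_mul, hr1]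
          simp
          ring
  have hL1' : ∫ x, |r x - 1| ∂p ≤ Real.log s := by
    have := one_sub_mul_sub_one_le ha hs
    by_contra! hcon
    nlinarith
  have hgi : Integrable (fun x => (g x - c) * (r x - 1)) p := by
    refine Integrable.bdd_mul (c := δ / 2) hr' (hg.sub aestronglyMeasurable_const) ?_
    simpa using hgc
  -- Since r - 1 has mean zero, g may be recentred at the middle of its range, which gains a factor
  -- 1/2.
  have hcenter : ∫ x, g x * (r x - 1) ∂p = ∫ x, (g x - c) * (r x - 1) ∂p := by
    have h0 : ∫ x, c * (r x - 1) ∂p = 0 := by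
      rw [integral_const_mul, integral_sub hr (integrable_const _), hr1]
      simp
    rw [← add_zero (∫ x, (g x - c) * (r x - 1) ∂p), ← h0, ← integral_add hgi (hr'.const_mul c)]
    congr 1 with x
    ring
  rw [hcenter]
  calc |∫ x, (g x - c) * (r x - 1) ∂p| ≤ ∫ x, |(g x - c) * (r x - 1)| ∂p := abs_integral_le_integral_abs
    _ ≤ ∫ x, δ / 2 * |r x - 1| ∂p := by
        refine integral_mono_ae hgi.abs (habs.const_mul _) ?_
        filter_upwards [hgc] with x hx
        rw [abs_mul]
        exact mul_le_mul_of_nonneg_right hx (abs_nonneg _)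
    _ ≤ Real.log s / 2 * δ := by
        rw [integral_const_mul]
        nlinarith

theorem exists_forall_abs_sub_le_half {Ω : Type*} {A : Set Ω} (hA : A.Nonempty) {g : Ω → ℝ} {δ : ℝ}
    (hg : ∀ x ∈ A, ∀ y ∈ A, g x - g y ≤ δ) : ∃ c, ∀ x ∈ A, |g x - c| ≤ δ / 2 := by
  obtain ⟨x₀, h₀⟩ := hA
  have hbdd : BddBelow (g '' A) :=
    ⟨g x₀ - δ, by rintro _ ⟨x, hx, rfl⟩; linarith [hg x₀ h₀ x hx]⟩
  refine ⟨sInf (g '' A) + δ / 2, fun x hx => abs_le.2 ⟨?_, ?_⟩⟩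
  · linarith [csInf_le hbdd ⟨x, hx, rfl⟩]
  · have : g x - δ ≤ sInf (g '' A) := by
      refine le_csInf ⟨_, x, hx, rfl⟩ ?_
      rintro _ ⟨y, hy, rfl⟩
      linarith [hg x hx y hy]
    linarith

/-- Tilting a probability measure by a function of oscillation `ε` changes it by at most `ε / 4`
in total variation. -/
theorem abs_integral_tilted_sub_le {Ω : Type*} [MeasurableSpace Ω] {p : Measure Ω}
    [IsProbabilityMeasure p] {w g : Ω → ℝ} {A : Set Ω} {ε δ : ℝ}
    (hw : Measurable w) (hg : AEStronglyMeasurable g p) (hA : ∀ᵐ x ∂p, x ∈ A)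
    (hwA : ∀ x ∈ A, ∀ y ∈ A, w x - w y ≤ ε) (hgA : ∀ x ∈ A, ∀ y ∈ A, g x - g y ≤ δ) :
    |(∫ x, g x ∂(p.tilted w)) - ∫ x, g x ∂p| ≤ ε / 4 * δ := by
  have hne : A.Nonempty := let ⟨x, hx⟩ := hA.exists; ⟨x, hx⟩
  have hε : 0 ≤ ε := by
    obtain ⟨x, hx⟩ := hne
    simpa using hwA x hx x hx
  have hδ : 0 ≤ δ := by
    obtain ⟨x, hx⟩ := hne
    simpa using hgA x hx x hx
  obtain ⟨c, hc⟩ := exists_forall_abs_sub_le_half hne hgA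
  obtain ⟨e, he⟩ := exists_forall_abs_sub_le_half hne hwA
  have hexp : Integrable (fun x => Real.exp (w x)) p := by
    refine Integrable.of_bound hw.exp.aestronglyMeasurable (Real.exp (e + ε / 2)) ?_
    filter_upwards [hA] with x hx
    rw [Real.norm_eq_abs, abs_of_pos (Real.exp_pos _), Real.exp_le_exp]
    linarith [(abs_le.1 (he x hx)).2]
  have hRpos : 0 < ∫ x, Real.exp (w x) ∂p := integral_exp_pos hexp
  set R := ∫ x, Real.exp (w x) ∂p with hR
  have hgi : Integrable g p := by
    refine Integrable.of_bound hg (|c| + δ / 2) ?_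
    filter_upwards [hA] with x hx
    have := hc x hx
    rw [Real.norm_eq_abs]
    calc |g x| = |c + (g x - c)| := by ring_nf
      _ ≤ |c| + |g x - c| := abs_add_le _ _
      _ ≤ _ := by linarith
  have hri : Integrable (fun x => Real.exp (w x) / R) p := hexp.div_const R
  have hgri : Integrable (fun x => g x * (Real.exp (w x) / R)) p := by
    refine Integrable.bdd_mul (c := |c| + δ / 2) hri hg ?_
    filter_upwards [hA] with x hx
    have := hc x hx
    rw [Real.norm_eq_abs]
    calc |g x| = |c + (g x - c)| := by ring_nf
      _ ≤ |c| + |g x - c| := abs_add_le _ _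
      _ ≤ _ := by linarith
  have hkey : (∫ x, g x ∂(p.tilted w)) - ∫ x, g x ∂p = ∫ x, g x * (Real.exp (w x) / R - 1) ∂p := by
    rw [integral_tilted, ← integral_sub _ hgi]
    · congr 1 with x
      simp only [smul_eq_mul]
      ring
    · refine hgri.congr (ae_of_all _ fun x => ?_)
      simp only [smul_eq_mul]
      ring
  rw [hkey]
  -- The density bound needs a ratio strictly above one, while ε may vanish; the slack η is sent to
  -- zero at the end.
  have main : ∀ η : ℝ, 0 < η → |∫ x, g x * (Real.exp (w x) / R - 1) ∂p| ≤ (ε + η) / 4 * δ := by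
    intro η hη
    have hs : 1 < Real.exp ((ε + η) / 2) := Real.one_lt_exp_iff.2 (by linarith)
    have := abs_integral_mul_sub_one_le (p := p) (r := fun x => Real.exp (w x) / R) (g := g)
      (a := Real.exp (e - ε / 2) / R) (s := Real.exp ((ε + η) / 2)) (δ := δ) (c := c)
      (div_pos (Real.exp_pos _) hRpos) hs hri hg
      (by rw [integral_div, ← hR, div_self hRpos.ne'])
      (by
        filter_upwards [hA] with x hx
        refine div_le_div_of_nonneg_right (Real.exp_le_exp.2 ?_) hRpos.le
        linarith [(abs_le.1 (he x hx)).1])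
      (by
        filter_upwards [hA] with x hx
        rw [div_mul_eq_mul_div, ← Real.exp_nat_mul, ← Real.exp_add]
        refine div_le_div_of_nonneg_right (Real.exp_le_exp.2 ?_) hRpos.le
        push_cast
        linarith [(abs_le.1 (he x hx)).2])
      (by filter_upwards [hA] with x hx using hc x hx)
    rw [Real.log_exp] at this
    linarith
  refine le_of_forall_pos_le_add fun η hη => ?_
  have h4 : 0 < 4 * η / (δ + 1) := by positivity
  have h5 : 4 * η / (δ + 1) / 4 * δ ≤ η := by
    rw [show 4 * η / (δ + 1) / 4 * δ = η * (δ / (δ + 1)) by field_simp]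
    exact mul_le_of_le_one_right hη.le (div_le_one_of_le₀ (by linarith) (by linarith))
  linarith [main _ h4, add_div ε (4 * η / (δ + 1)) 4, add_mul (ε / 4) (4 * η / (δ + 1) / 4) δ,
    show (ε + 4 * η / (δ + 1)) / 4 * δ = ε / 4 * δ + 4 * η / (δ + 1) / 4 * δ by ring]

end TotalVariation

/-! ### Finite-volume Gibbs distributions on a compact spin space -/

section LocalGibbs

open Function Filter Topology

theorem integrable_of_continuous_of_compactSpace {Y : Type*} [TopologicalSpace Y] [CompactSpace Y]
    [MeasurableSpace Y] [OpensMeasurableSpace Y] (μ : Measure Y) [IsFiniteMeasure μ] {f : Y → ℝ}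
    (hf : Continuous f) : Integrable f μ :=
  BoundedContinuousFunction.integrable μ (BoundedContinuousFunction.mkOfCompact ⟨f, hf⟩)

theorem exists_abs_le_of_continuous {Y : Type*} [TopologicalSpace Y] [CompactSpace Y] {f : Y → ℝ}
    (hf : Continuous f) : ∃ C : ℝ, ∀ y, |f y| ≤ C :=
  ⟨_, fun y => (BoundedContinuousFunction.mkOfCompact ⟨f, hf⟩).norm_coe_le_norm y⟩

theorem continuous_integral_of_compactSpace {Y Z : Type*} [TopologicalSpace Y] [CompactSpace Y]
    [FirstCountableTopology Y] [TopologicalSpace Z] [CompactSpace Z] [MeasurableSpace Z]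
    [OpensMeasurableSpace Z] (ν : Measure Z) [IsFiniteMeasure ν] {G : Y → Z → ℝ}
    (hG : Continuous fun p : Y × Z => G p.1 p.2) : Continuous fun y => ∫ z, G y z ∂ν := by
  obtain ⟨C, hC⟩ := exists_abs_le_of_continuous hG
  refine continuous_of_dominated (bound := fun _ => C) (fun y => ?_) (fun y => ?_)
    (integrable_const C) (ae_of_all _ fun z => ?_)
  · have h : Continuous (G y) := hG.comp (Continuous.prodMk_right y)
    exact h.measurable.aestronglyMeasurable
  · exact ae_of_all _ fun z => hC (y, z)
  · exact hG.comp (Continuous.prodMk_left z)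

theorem integral_bind_of_continuous {Y Z : Type*} [MeasurableSpace Y] [TopologicalSpace Z]
    [CompactSpace Z] [MeasurableSpace Z] [OpensMeasurableSpace Z] (μ : Measure Y)
    [IsProbabilityMeasure μ] (κ : Kernel Y Z) [IsMarkovKernel κ] {f : Z → ℝ} (hf : Continuous f) :
    ∫ z, f z ∂(μ.bind κ) = ∫ y, ∫ z, f z ∂(κ y) ∂μ := by
  have h := Measure.comp_eq_comp_const_apply (μ := μ) (κ := κ)
  have hint : Integrable f ((κ ∘ₖ Kernel.const Unit μ) ()) :=
    integrable_of_continuous_of_compactSpace _ hf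
  rw [h, Kernel.integral_comp hint]
  simp

variable {V X : Type*} [DecidableEq V] [TopologicalSpace X] [CompactSpace X] [T2Space X]
  [SecondCountableTopology X] [MeasurableSpace X] [BorelSpace X]

theorem continuous_updateFinset_prod (Λ : Finset V) :
    Continuous fun p : (V → X) × (Λ → X) => updateFinset p.1 Λ p.2 := by
  refine continuous_pi fun x => ?_
  by_cases h : x ∈ Λ
  · simp only [updateFinset, h, dite_true]
    exact (continuous_apply _).comp continuous_snd
  · simp only [updateFinset, h, dite_false]
    exact (continuous_apply x).comp continuous_fst

/-- The probability measure on configurations that agrees with `η` off `Λ` and whose density in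
`Λ` relative to the product of the measures `m x` is proportional to `exp (U Λ)`. -/
noncomputable def localGibbs (m : V → Measure X) (U : Finset V → (V → X) → ℝ) (Λ : Finset V)
    (η : V → X) : Measure (V → X) :=
  ((Measure.pi fun x : Λ => m x).tilted fun ζ => U Λ (updateFinset η Λ ζ)).map (updateFinset η Λ)

/-- Continuous finite-volume energies such that the energy in `Λ` is the energy in `Δ ⊆ Λ` up to
a function of the configuration off `Δ`. -/
structure IsEnergy (U : Finset V → (V → X) → ℝ) : Prop where
  continuous : ∀ Λ, Continuous (U Λ)
  consistent : ∀ {Δ Λ : Finset V}, Δ ⊆ Λ → ∀ {ω ω' : V → X}, (∀ x ∉ Δ, ω x = ω' x) →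
    U Λ ω - U Δ ω = U Λ ω' - U Δ ω'

variable (m : V → Measure X) [∀ x, IsFiniteMeasure (m x)] [∀ x, NeZero (m x)]
  {U : Finset V → (V → X) → ℝ}

instance neZero_pi (Λ : Finset V) : NeZero (Measure.pi fun x : Λ => m x) := by
  refine ⟨fun h => ?_⟩
  have h1 : (Measure.pi fun x : Λ => m x) Set.univ = 0 := by rw [h]; rfl
  rw [Measure.pi_univ, Finset.prod_eq_zero_iff] at h1
  obtain ⟨x, -, hx⟩ := h1
  exact NeZero.ne (m x) (Measure.measure_univ_eq_zero.1 hx)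

theorem IsEnergy.continuous_updateFinset (hU : IsEnergy U) (Λ : Finset V) (η : V → X) :
    Continuous fun ζ : Λ → X => U Λ (updateFinset η Λ ζ) :=
  (hU.continuous Λ).comp ((continuous_updateFinset_prod Λ).comp (Continuous.prodMk_right η))

theorem IsEnergy.integrable_exp (hU : IsEnergy U) (Λ : Finset V) (η : V → X) :
    Integrable (fun ζ : Λ → X => Real.exp (U Λ (updateFinset η Λ ζ)))
      (Measure.pi fun x : Λ => m x) :=
  integrable_of_continuous_of_compactSpace _ (hU.continuous_updateFinset Λ η).rexp

theorem IsEnergy.isProbabilityMeasure_tilted (hU : IsEnergy U) (Λ : Finset V) (η : V → X) :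
    IsProbabilityMeasure
      ((Measure.pi fun x : Λ => m x).tilted fun ζ => U Λ (updateFinset η Λ ζ)) :=
  MeasureTheory.isProbabilityMeasure_tilted (hU.integrable_exp m Λ η)

theorem IsEnergy.isProbabilityMeasure_localGibbs (hU : IsEnergy U) (Λ : Finset V) (η : V → X) :
    IsProbabilityMeasure (localGibbs m U Λ η) :=
  have := hU.isProbabilityMeasure_tilted m Λ η
  Measure.isProbabilityMeasure_map measurable_updateFinset.aemeasurable

theorem ae_tilted_mem {Λ : Finset V} (η : V → X) {E : V → Set X}
    (hE : ∀ x, ∀ᵐ s ∂(m x), s ∈ E x) :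
    ∀ᵐ ζ ∂((Measure.pi fun x : Λ => m x).tilted fun ζ => U Λ (updateFinset η Λ ζ)),
      ∀ x : Λ, ζ x ∈ E x := by
  refine (tilted_absolutelyContinuous _ _).ae_le (ae_all_iff.2 ?_)
  exact fun x => (Measure.quasiMeasurePreserving_eval (fun x : Λ => m x) x).ae (hE x)

variable [Countable V]

theorem integral_localGibbs (Λ : Finset V) (η : V → X) {f : (V → X) → ℝ} (hf : Continuous f) :
    ∫ ω, f ω ∂(localGibbs m U Λ η) = ∫ ζ, f (updateFinset η Λ ζ)
      ∂((Measure.pi fun x : Λ => m x).tilted fun ζ => U Λ (updateFinset η Λ ζ)) :=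
  integral_map measurable_updateFinset.aemeasurable hf.measurable.aestronglyMeasurable

theorem IsEnergy.measurable_density (hU : IsEnergy U) (Λ : Finset V) :
    Measurable fun ω => ENNReal.ofReal (Real.exp (U Λ ω)) :=
  (hU.continuous Λ).measurable.exp.ennreal_ofReal

/-- As a quotient of `lmarginal`s the expectation is visibly measurable in η, and nested volumes
become iterated marginals. -/
theorem IsEnergy.lintegral_localGibbs (hU : IsEnergy U) (Λ : Finset V) (η : V → X)
    {g : (V → X) → ℝ≥0∞} (hg : Measurable g) :
    ∫⁻ ω, g ω ∂(localGibbs m U Λ η) =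
      lmarginal m Λ (fun ω => ENNReal.ofReal (Real.exp (U Λ ω)) * g ω) η /
        lmarginal m Λ (fun ω => ENNReal.ofReal (Real.exp (U Λ ω))) η := by
  have hZ : lmarginal m Λ (fun ω => ENNReal.ofReal (Real.exp (U Λ ω))) η =
      ENNReal.ofReal (∫ ζ, Real.exp (U Λ (updateFinset η Λ ζ)) ∂(Measure.pi fun x : Λ => m x)) :=
    (ofReal_integral_eq_lintegral_ofReal (hU.integrable_exp m Λ η)
      (ae_of_all _ fun _ => (Real.exp_pos _).le)).symm
  rw [hZ, localGibbs, lintegral_map hg measurable_updateFinset, lintegral_tilted, lmarginal,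
    div_eq_mul_inv, ← lintegral_mul_const]
  · refine lintegral_congr fun ζ => ?_
    rw [div_eq_mul_inv, ENNReal.ofReal_mul (Real.exp_pos _).le,
      ENNReal.ofReal_inv_of_pos (integral_exp_pos (hU.integrable_exp m Λ η))]
    ring
  · exact ((hU.measurable_density Λ).mul hg).comp measurable_updateFinset

theorem IsEnergy.localGibbs_apply (hU : IsEnergy U) (Λ : Finset V) (η : V → X)
    {B : Set (V → X)} (hB : MeasurableSet B) :
    localGibbs m U Λ η B =
      lmarginal m Λ (fun ω => ENNReal.ofReal (Real.exp (U Λ ω)) * B.indicator 1 ω) η /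
        lmarginal m Λ (fun ω => ENNReal.ofReal (Real.exp (U Λ ω))) η := by
  rw [← hU.lintegral_localGibbs m Λ η (measurable_one.indicator hB), lintegral_indicator_one hB]

theorem IsEnergy.measurable_localGibbs (hU : IsEnergy U) (Λ : Finset V) :
    Measurable (localGibbs m U Λ) := by
  refine Measure.measurable_of_measurable_coe _ fun B hB => ?_
  simp_rw [hU.localGibbs_apply m Λ _ hB]
  exact (((hU.measurable_density Λ).mul (measurable_one.indicator hB)).lmarginal m).div
    ((hU.measurable_density Λ).lmarginal m)

/-- The finite-volume Gibbs distribution as a Markov kernel. -/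
noncomputable def IsEnergy.kernel (hU : IsEnergy U) (Λ : Finset V) : Kernel (V → X) (V → X) :=
  ⟨localGibbs m U Λ, hU.measurable_localGibbs m Λ⟩

instance IsEnergy.isMarkovKernel (hU : IsEnergy U) (Λ : Finset V) :
    IsMarkovKernel (hU.kernel m Λ) :=
  ⟨hU.isProbabilityMeasure_localGibbs m Λ⟩

/-- Consistency of the specification. The factor `exp (U Λ - U Δ)` does not depend on the spins in
Δ, so it leaves the marginal over Δ; neither does the kernel of Δ, so integrating it over Δ only
produces the partition function in its own denominator. -/
theorem IsEnergy.bind_localGibbs (hU : IsEnergy U) {Δ Λ : Finset V} (h : Δ ⊆ Λ) (η : V → X) :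
    (localGibbs m U Λ η).bind (localGibbs m U Δ) = localGibbs m U Λ η := by
  ext B hB
  have hK : Measurable fun ω => localGibbs m U Δ ω B :=
    (Measure.measurable_coe hB).comp (hU.measurable_localGibbs m Δ)
  rw [Measure.bind_apply hB (hU.measurable_localGibbs m Δ).aemeasurable,
    hU.lintegral_localGibbs m Λ η hK, hU.localGibbs_apply m Λ η hB]
  congr 1
  refine congrFun (lmarginal_eq_of_subset h
    ((hU.measurable_density Λ).mul hK)
    ((hU.measurable_density Λ).mul (measurable_one.indicator hB)) (funext fun ω => ?_)) η
  have hr : ∀ ζ : Δ → X, ENNReal.ofReal (Real.exp (U Λ (updateFinset ω Δ ζ))) =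
      ENNReal.ofReal (Real.exp (U Λ ω - U Δ ω)) *
        ENNReal.ofReal (Real.exp (U Δ (updateFinset ω Δ ζ))) := fun ζ => by
    rw [← ENNReal.ofReal_mul (Real.exp_pos _).le, ← Real.exp_add,
      hU.consistent h (ω := ω) (ω' := updateFinset ω Δ ζ) fun x hx => by
        simp [updateFinset, hx], sub_add_cancel]
  have hpull : ∀ g : (V → X) → ℝ≥0∞, Measurable g →
      lmarginal m Δ (fun ω => ENNReal.ofReal (Real.exp (U Λ ω)) * g ω) ω =
        ENNReal.ofReal (Real.exp (U Λ ω - U Δ ω)) *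
          lmarginal m Δ (fun ω => ENNReal.ofReal (Real.exp (U Δ ω)) * g ω) ω := fun g hg => by
    simp only [lmarginal]
    rw [← lintegral_const_mul]
    · refine lintegral_congr fun ζ => ?_
      rw [hr, mul_assoc]
    · exact ((hU.measurable_density Δ).mul hg).comp measurable_updateFinset
  refine (hpull _ hK).trans (Eq.trans ?_ (hpull _ (measurable_one.indicator hB)).symm)
  congr 1
  have hconst : ∀ ζ : Δ → X, localGibbs m U Δ (updateFinset ω Δ ζ) B = localGibbs m U Δ ω B := by
    intro ζ
    have hag : ∀ x ∉ Δ, updateFinset ω Δ ζ x = ω x := fun x hx => by simp [updateFinset, hx]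
    rw [hU.localGibbs_apply m Δ _ hB, hU.localGibbs_apply m Δ _ hB, lmarginal_congr m _ hag,
      lmarginal_congr m (fun ω => ENNReal.ofReal (Real.exp (U Δ ω))) hag]
  have hZ : lmarginal m Δ (fun ω => ENNReal.ofReal (Real.exp (U Δ ω))) ω =
      ENNReal.ofReal (∫ ζ, Real.exp (U Δ (updateFinset ω Δ ζ)) ∂(Measure.pi fun x : Δ => m x)) :=
    (ofReal_integral_eq_lintegral_ofReal (hU.integrable_exp m Δ ω)
      (ae_of_all _ fun _ => (Real.exp_pos _).le)).symm
  have hZ0 : lmarginal m Δ (fun ω => ENNReal.ofReal (Real.exp (U Δ ω))) ω ≠ 0 := by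
    rw [hZ]
    exact (ENNReal.ofReal_pos.2 (integral_exp_pos (hU.integrable_exp m Δ ω))).ne'
  have hZt : lmarginal m Δ (fun ω => ENNReal.ofReal (Real.exp (U Δ ω))) ω ≠ ∞ := by
    rw [hZ]
    exact ENNReal.ofReal_ne_top
  calc lmarginal m Δ (fun ω => ENNReal.ofReal (Real.exp (U Δ ω)) * localGibbs m U Δ ω B) ω
      = lmarginal m Δ (fun ω => ENNReal.ofReal (Real.exp (U Δ ω))) ω * localGibbs m U Δ ω B := by
        simp only [lmarginal, hconst]
        exact lintegral_mul_const _ ((hU.measurable_density Δ).comp measurable_updateFinset)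
    _ = _ := by
        rw [hU.localGibbs_apply m Δ ω hB, ENNReal.mul_div_cancel hZ0 hZt]

/-- The Feller property, which lets the DLR equations pass to weak limits. -/
theorem IsEnergy.continuous_integral_localGibbs (hU : IsEnergy U) (Λ : Finset V)
    {f : (V → X) → ℝ} (hf : Continuous f) : Continuous fun η => ∫ ω, f ω ∂(localGibbs m U Λ η) := by
  have h : ∀ η, ∫ ω, f ω ∂(localGibbs m U Λ η) =
      (∫ ζ, Real.exp (U Λ (updateFinset η Λ ζ)) * f (updateFinset η Λ ζ)
        ∂(Measure.pi fun x : Λ => m x)) /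
      ∫ ζ, Real.exp (U Λ (updateFinset η Λ ζ)) ∂(Measure.pi fun x : Λ => m x) := fun η => by
    rw [integral_localGibbs m Λ η hf, integral_tilted, ← integral_div]
    refine integral_congr_ae (ae_of_all _ fun ζ => ?_)
    simp only [smul_eq_mul]
    ring
  simp_rw [h]
  have hE := ((hU.continuous Λ).comp (continuous_updateFinset_prod (X := X) Λ)).rexp
  refine Continuous.div (continuous_integral_of_compactSpace _
    (hE.mul (hf.comp (continuous_updateFinset_prod Λ))))
    (continuous_integral_of_compactSpace _ hE) fun η => ?_
  exact (integral_exp_pos (hU.integrable_exp m Λ η)).ne'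

/-- Gibbs measures for the finite-volume distributions `localGibbs`. -/
def IsLocalGibbs (U : Finset V → (V → X) → ℝ) (μ : Measure (V → X)) : Prop :=
  IsProbabilityMeasure μ ∧ ∀ Λ, μ.bind (localGibbs m U Λ) = μ

theorem IsEnergy.integral_integral_localGibbs (hU : IsEnergy U) {μ : Measure (V → X)}
    [IsProbabilityMeasure μ] {Λ : Finset V} (hμ : μ.bind (localGibbs m U Λ) = μ)
    {f : (V → X) → ℝ} (hf : Continuous f) :
    ∫ η, ∫ ω, f ω ∂(localGibbs m U Λ η) ∂μ = ∫ ω, f ω ∂μ := by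
  have h := integral_bind_of_continuous μ (hU.kernel m Λ) hf
  have h2 : μ.bind (hU.kernel m Λ) = μ := hμ
  rw [h2] at h
  exact h.symm

theorem IsEnergy.exists_isLocalGibbs [Nonempty X] (hU : IsEnergy U) :
    ∃ μ, IsLocalGibbs m U μ := by
  have η : V → X := fun _ => Classical.arbitrary X
  let P : Finset V → ProbabilityMeasure (V → X) :=
    fun Λ => ⟨localGibbs m U Λ η, hU.isProbabilityMeasure_localGibbs m Λ η⟩
  -- An ultrafilter finer than `atTop` picks a limit point of the finite-volume distributions in the
  -- compact space of probability measures; eventually its volumes contain any given Δ, and there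
  -- the DLR equation for Δ is consistency.
  let F : Ultrafilter (Finset V) := Ultrafilter.of atTop
  obtain ⟨μ, -, hμ⟩ := isCompact_univ.ultrafilter_le_nhds (F.map P) (by simp)
  have hlim : Tendsto P F (𝓝 μ) := hμ
  rw [ProbabilityMeasure.tendsto_iff_forall_integral_tendsto] at hlim
  refine ⟨μ, inferInstance, fun Δ => ?_⟩
  have : IsProbabilityMeasure ((μ : Measure (V → X)).bind (localGibbs m U Δ)) :=
    inferInstanceAs (IsProbabilityMeasure ((μ : Measure (V → X)).bind (hU.kernel m Δ)))
  refine ext_of_forall_integral_eq_of_IsFiniteMeasure fun f => ?_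
  have h1 : ∫ ω, f ω ∂((μ : Measure (V → X)).bind (localGibbs m U Δ)) =
      ∫ η, ∫ ω, f ω ∂(localGibbs m U Δ η) ∂(μ : Measure (V → X)) :=
    integral_bind_of_continuous (μ : Measure (V → X)) (hU.kernel m Δ) f.continuous
  rw [h1]
  have h2 := hlim (BoundedContinuousFunction.mkOfCompact
    ⟨_, hU.continuous_integral_localGibbs m Δ f.continuous⟩)
  refine tendsto_nhds_unique h2 ((hlim f).congr' ?_)
  have hev : ∀ᶠ Λ in (F : Filter (Finset V)), Δ ⊆ Λ :=
    (Ultrafilter.of_le atTop) (eventually_ge_atTop Δ)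
  filter_upwards [hev] with Λ hΛ
  have := hU.isProbabilityMeasure_localGibbs m Λ η
  exact (hU.integral_integral_localGibbs m (hU.bind_localGibbs m hΛ η) f.continuous).symm

end LocalGibbs

/-! ### Dobrushin's comparison and uniqueness theorems -/

section Comparison

open Function Filter Topology
open scoped NNReal

variable {V X : Type*} [DecidableEq V] [TopologicalSpace X] [CompactSpace X] [T2Space X]
  [SecondCountableTopology X] [MeasurableSpace X] [BorelSpace X]

theorem updateFinset_singleton_eq (η : V → X) (x : V) (ζ : ({x} : Finset V) → X) :
    updateFinset η {x} ζ = update η x (ζ ⟨x, Finset.mem_singleton_self x⟩) := by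
  ext y
  by_cases h : y = x
  · subst h
    simp [updateFinset]
  · simp [updateFinset, h]

/-- `δ z` bounds the oscillation of `f` at the site `z`, among configurations with all spins in
the sets `E`. -/
def OscBound (E : V → Set X) (f : (V → X) → ℝ) (δ : V → ℝ≥0) : Prop :=
  ∀ z (η ζ : V → X), (∀ x, η x ∈ E x) → (∀ x, ζ x ∈ E x) → (∀ y, y ≠ z → η y = ζ y) →
    |f η - f ζ| ≤ δ z

theorem OscBound.abs_sub_updateFinset_le {E : V → Set X} {f : (V → X) → ℝ} {δ : V → ℝ≥0}
    (h : OscBound E f δ) {η ζ : V → X} (hη : ∀ x, η x ∈ E x) (hζ : ∀ x, ζ x ∈ E x)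
    (F : Finset V) : |f η - f (updateFinset η F fun x => ζ x)| ≤ ∑ z ∈ F, (δ z : ℝ) := by
  induction F using Finset.induction with
  | empty => simp [updateFinset_def]
  | insert z F hz ih =>
    rw [Finset.sum_insert hz]
    have hmem : ∀ (F : Finset V) (x : V), updateFinset η F (fun x => ζ x) x ∈ E x := fun F x => by
      by_cases hx : x ∈ F
      · simpa [updateFinset, hx] using hζ x
      · simpa [updateFinset, hx] using hη x
    have := h z _ _ (hmem F) (hmem (insert z F)) fun y hy => by simp [updateFinset, hy]
    calc _ = |(f η - f (updateFinset η F fun x => ζ x)) + (f (updateFinset η F fun x => ζ x) -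
          f (updateFinset η (insert z F) fun x => ζ x))| := by ring_nf
      _ ≤ _ := (abs_add_le _ _).trans (by linarith)

/-- Spins are exchanged one at a time; continuity of f takes care of infinitely many. -/
theorem OscBound.abs_sub_le_tsum {E : V → Set X} {f : (V → X) → ℝ} (hf : Continuous f)
    {δ : V → ℝ≥0} (h : OscBound E f δ) (hδ : Summable fun z => (δ z : ℝ)) {η ζ : V → X}
    (hη : ∀ x, η x ∈ E x) (hζ : ∀ x, ζ x ∈ E x) : |f η - f ζ| ≤ ∑' z, (δ z : ℝ) := by
  have hlim : Tendsto (fun F : Finset V => updateFinset η F fun x => ζ x) atTop (𝓝 ζ) := by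
    refine tendsto_pi_nhds.2 fun x => tendsto_const_nhds.congr' ?_
    filter_upwards [eventually_ge_atTop {x}] with F hF
    have : x ∈ F := hF (Finset.mem_singleton_self x)
    simp [updateFinset, this]
  refine le_of_tendsto ((tendsto_const_nhds.sub ((hf.tendsto ζ).comp hlim)).abs) ?_
  exact Eventually.of_forall fun F => (h.abs_sub_updateFinset_le hη hζ F).trans
    (hδ.sum_le_tsum F fun z _ => (δ z).2)

theorem abs_integral_le_of_ae_abs_le {Y : Type*} [MeasurableSpace Y] {μ : Measure Y}
    [IsProbabilityMeasure μ] {f : Y → ℝ} {M : ℝ} (h : ∀ᵐ y ∂μ, |f y| ≤ M) :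
    |∫ y, f y ∂μ| ≤ M := by
  simpa using norm_integral_le_of_norm_le_const (f := f) (μ := μ) (C := M) h

theorem abs_integral_sub_integral_le {Y : Type*} [MeasurableSpace Y] {μ ν : Measure Y}
    [IsProbabilityMeasure μ] [IsProbabilityMeasure ν] {A : Set Y} (hμ : ∀ᵐ y ∂μ, y ∈ A)
    (hν : ∀ᵐ y ∂ν, y ∈ A) {f : Y → ℝ} (hfμ : Integrable f μ) (hfν : Integrable f ν) {M : ℝ}
    (h : ∀ y ∈ A, ∀ z ∈ A, |f y - f z| ≤ M) : |(∫ y, f y ∂μ) - ∫ y, f y ∂ν| ≤ M := by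
  have h1 : ∀ y ∈ A, |f y - ∫ z, f z ∂ν| ≤ M := fun y hy => by
    have : f y - ∫ z, f z ∂ν = ∫ z, (f y - f z) ∂ν := by
      rw [integral_sub (integrable_const _) hfν]
      simp
    rw [this]
    refine abs_integral_le_of_ae_abs_le ?_
    filter_upwards [hν] with z hz using h y hy z hz
  have : (∫ y, f y ∂μ) - ∫ y, f y ∂ν = ∫ y, (f y - ∫ z, f z ∂ν) ∂μ := by
    rw [integral_sub hfμ (integrable_const _)]
    simp
  rw [this]
  refine abs_integral_le_of_ae_abs_le ?_
  filter_upwards [hμ] with y hy using h1 y hy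

variable [Countable V] (m m' : V → Measure X) [∀ x, IsFiniteMeasure (m x)] [∀ x, NeZero (m x)]
  [∀ x, IsFiniteMeasure (m' x)] [∀ x, NeZero (m' x)] {U : Finset V → (V → X) → ℝ}

theorem localGibbs_congr {m m' : V → Measure X} {Λ : Finset V} (h : ∀ x ∈ Λ, m x = m' x)
    (U : Finset V → (V → X) → ℝ) : localGibbs m U Λ = localGibbs m' U Λ := by
  have : (fun x : Λ => m x) = fun x : Λ => m' x := funext fun x => h x x.2
  ext1 η
  rw [localGibbs, localGibbs, this]

/-- By the DLR equation in `{x}`, the law of the spin at x is a mixture of laws absolutely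
continuous with respect to `m x`. -/
theorem IsEnergy.ae_mem_of_isLocalGibbs (hU : IsEnergy U) {μ : Measure (V → X)}
    (hμ : IsLocalGibbs m U μ) {E : V → Set X} (hEm : ∀ x, MeasurableSet (E x))
    (hE : ∀ x, ∀ᵐ s ∂(m x), s ∈ E x) : ∀ᵐ ω ∂μ, ∀ x, ω x ∈ E x := by
  refine ae_all_iff.2 fun x => ?_
  have hB : MeasurableSet {ω : V → X | ω x ∉ E x} := (hEm x).compl.preimage (measurable_pi_apply x)
  have hK : Measurable fun η => localGibbs m U {x} η {ω | ω x ∉ E x} :=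
    (Measure.measurable_coe hB).comp (hU.measurable_localGibbs m {x})
  rw [ae_iff, ← hμ.2 {x}, Measure.bind_apply hB (hU.measurable_localGibbs m {x}).aemeasurable,
    lintegral_eq_zero_iff hK]
  refine ae_of_all _ fun η => ?_
  simp only [Pi.zero_apply, localGibbs]
  rw [Measure.map_apply measurable_updateFinset hB]
  refine measure_mono_null ?_ (ae_iff.1 (ae_tilted_mem m (U := U) (Λ := {x}) η hE))
  intro ζ hζ hcon
  refine hζ ?_
  have := hcon ⟨x, Finset.mem_singleton_self x⟩
  simpa [updateFinset] using this

/-- The single-site distribution at `x` transfers the oscillation at `x` to the other sites. -/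
theorem IsEnergy.oscBound_localGibbs (hU : IsEnergy U) {E : V → Set X}
    (hE : ∀ x, ∀ᵐ s ∂(m x), s ∈ E x) {x : V} {c : V → ℝ≥0}
    (hc : ∀ w, w ≠ x → ∀ η ζ : V → X, (∀ y, η y ∈ E y) → (∀ y, ζ y ∈ E y) →
      (∀ y, y ≠ w → η y = ζ y) → ∀ s t : X,
        (U {x} (update η x s) - U {x} (update ζ x s)) -
          (U {x} (update η x t) - U {x} (update ζ x t)) ≤ 4 * c w)
    {f : (V → X) → ℝ} (hf : Continuous f) {δ : V → ℝ≥0} (hδ : OscBound E f δ) :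
    OscBound E (fun η => ∫ ω, f ω ∂(localGibbs m U {x} η))
      fun w => if w = x then 0 else δ w + c w * δ x := by
  intro w η ζ hη hζ hagree
  by_cases hwx : w = x
  · subst hwx
    have hupd : ∀ ξ : ({w} : Finset V) → X, updateFinset η {w} ξ = updateFinset ζ {w} ξ := by
      intro ξ
      ext y
      by_cases hy : y = w
      · simp [updateFinset, hy]
      · simp [updateFinset, hy, hagree y hy]
    simp only [integral_localGibbs m _ _ hf, hupd]
    simp
  · simp only [hwx, if_false]
    set p := (Measure.pi fun y : ({x} : Finset V) => m y) with hp
    set u := fun ξ : ({x} : Finset V) → X => U {x} (updateFinset η {x} ξ) with hu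
    set v := fun ξ : ({x} : Finset V) → X => U {x} (updateFinset ζ {x} ξ) with hv
    have hucont : Continuous u := hU.continuous_updateFinset {x} η
    have hvcont : Continuous v := hU.continuous_updateFinset {x} ζ
    have hPu : IsProbabilityMeasure (p.tilted u) := hU.isProbabilityMeasure_tilted m {x} η
    have hPv : IsProbabilityMeasure (p.tilted v) := hU.isProbabilityMeasure_tilted m {x} ζ
    -- The two single-site laws differ by a tilt with u - v, whose oscillation `hc` bounds by 4 c w.
    -- The total variation bound turns this into c w, while `h1` accounts for the change of the
    -- integrand under a fixed law.
    have htilt : p.tilted u = (p.tilted v).tilted (u - v) := by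
      rw [tilted_tilted (hU.integrable_exp m {x} ζ), add_sub_cancel]
    have hfc : ∀ η : V → X, Continuous fun ξ : ({x} : Finset V) → X => f (updateFinset η {x} ξ) :=
      fun η => hf.comp ((continuous_updateFinset_prod {x}).comp (Continuous.prodMk_right η))
    let A : Set (({x} : Finset V) → X) := {ξ | ∀ y : ({x} : Finset V), ξ y ∈ E y}
    have hmem : ∀ η : V → X, (∀ y, η y ∈ E y) → ∀ ξ ∈ A, ∀ y, updateFinset η {x} ξ y ∈ E y := by
      intro η hη ξ hξ y
      by_cases hy : y ∈ ({x} : Finset V)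
      · simpa [updateFinset, hy] using hξ ⟨y, hy⟩
      · simpa only [updateFinset, hy, dite_false] using hη y
    rw [integral_localGibbs m _ _ hf, integral_localGibbs m _ _ hf]
    have h1 : |(∫ ξ, f (updateFinset η {x} ξ) ∂(p.tilted u)) -
        ∫ ξ, f (updateFinset ζ {x} ξ) ∂(p.tilted u)| ≤ δ w := by
      rw [← integral_sub (integrable_of_continuous_of_compactSpace _ (hfc η))
        (integrable_of_continuous_of_compactSpace _ (hfc ζ))]
      refine abs_integral_le_of_ae_abs_le ?_
      filter_upwards [ae_tilted_mem m (U := U) (Λ := {x}) η hE] with ξ hξ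
      refine hδ w _ _ (hmem η hη ξ hξ) (hmem ζ hζ ξ hξ) fun y hy => ?_
      by_cases hyx : y ∈ ({x} : Finset V)
      · simp [updateFinset, hyx]
      · simp only [updateFinset, hyx, dite_false]
        exact hagree y hy
    have h2 : |(∫ ξ, f (updateFinset ζ {x} ξ) ∂(p.tilted u)) -
        ∫ ξ, f (updateFinset ζ {x} ξ) ∂(p.tilted v)| ≤ 4 * c w / 4 * δ x := by
      rw [htilt]
      refine abs_integral_tilted_sub_le (A := A) (hucont.sub hvcont).measurable
        (hfc ζ).measurable.aestronglyMeasurable (ae_tilted_mem m (U := U) (Λ := {x}) ζ hE)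
        (fun ξ hξ ξ' hξ' => ?_) (fun ξ hξ ξ' hξ' => ?_)
      · simp only [Pi.sub_apply, hu, hv, updateFinset_singleton_eq]
        exact hc w hwx η ζ hη hζ hagree _ _
      · refine (le_abs_self _).trans (hδ x _ _ (hmem ζ hζ ξ hξ) (hmem ζ hζ ξ' hξ') fun y hy => ?_)
        simp [updateFinset, hy]
    push_cast
    refine (abs_sub_le _ (∫ ξ, f (updateFinset ζ {x} ξ) ∂(p.tilted u)) _).trans ?_
    linarith

/-- The difference of `μ` and `ν` on a continuous function is at most the sum of its oscillations,
weighted by `a`. -/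
def IsEstimate (E : V → Set X) (μ ν : Measure (V → X)) (a : V → ℝ≥0∞) : Prop :=
  ∀ (f : (V → X) → ℝ) (δ : V → ℝ≥0), Continuous f → OscBound E f δ →
    ∑' z, (δ z : ℝ≥0∞) ≠ ∞ →
      ENNReal.ofReal |(∫ ω, f ω ∂μ) - ∫ ω, f ω ∂ν| ≤ ∑' z, a z * δ z

/-- The trivial estimate, from which the iteration starts. -/
theorem isEstimate_one {E : V → Set X} {μ ν : Measure (V → X)} [IsProbabilityMeasure μ]
    [IsProbabilityMeasure ν] (hμ : ∀ᵐ ω ∂μ, ∀ x, ω x ∈ E x) (hν : ∀ᵐ ω ∂ν, ∀ x, ω x ∈ E x) :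
    IsEstimate E μ ν fun _ => 1 := by
  intro f δ hf hδ hsum
  have hs : Summable δ := ENNReal.tsum_coe_ne_top_iff_summable.1 hsum
  have := abs_integral_sub_integral_le (A := {ω : V → X | ∀ x, ω x ∈ E x}) hμ hν
    (integrable_of_continuous_of_compactSpace μ hf)
    (integrable_of_continuous_of_compactSpace ν hf)
    fun η hη ζ hζ => hδ.abs_sub_le_tsum hf (NNReal.summable_coe.2 hs) hη hζ
  simp only [one_mul]
  rw [← ENNReal.coe_tsum hs, ← ENNReal.ofReal_coe_nnreal, NNReal.coe_tsum]
  exact ENNReal.ofReal_le_ofReal this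

theorem IsEstimate.mono {E : V → Set X} {μ ν : Measure (V → X)} {a b : V → ℝ≥0∞}
    (h : IsEstimate E μ ν a) (hab : ∀ z, a z ≤ b z) : IsEstimate E μ ν b :=
  fun f δ hf hδ hsum => (h f δ hf hδ hsum).trans
    (ENNReal.tsum_le_tsum fun z => mul_le_mul_left (hab z) _)

variable {m m'}

/-- Under both measures f may be replaced by its average over the spin at x, with the same kernel
because `m x = m' x`. The average no longer oscillates at x: the old oscillation `δ x` has been
passed to the sites w with factors `c w`, so the weight of `δ x` becomes the `c`-average of the
weights. -/
theorem IsEstimate.update (hU : IsEnergy U) {E : V → Set X} {μ ν : Measure (V → X)}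
    (hμ : IsLocalGibbs m U μ) (hν : IsLocalGibbs m' U ν) (hE : ∀ x, ∀ᵐ s ∂(m x), s ∈ E x)
    {x : V} (hx : m x = m' x) {c : V → ℝ≥0} (hcsum : ∑' w, (c w : ℝ≥0∞) ≠ ∞)
    (hc : ∀ w, w ≠ x → ∀ η ζ : V → X, (∀ y, η y ∈ E y) → (∀ y, ζ y ∈ E y) →
      (∀ y, y ≠ w → η y = ζ y) → ∀ s t : X,
        (U {x} (update η x s) - U {x} (update ζ x s)) -
          (U {x} (update η x t) - U {x} (update ζ x t)) ≤ 4 * c w)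
    {a : V → ℝ≥0∞} (ha : IsEstimate E μ ν a) :
    IsEstimate E μ ν (Function.update a x (∑' w, c w * a w)) := by
  intro f δ hf hδ hsum
  have := hμ.1
  have := hν.1
  have hδ' := hU.oscBound_localGibbs m hE hc hf hδ
  have hK : localGibbs m U {x} = localGibbs m' U {x} :=
    localGibbs_congr (fun y hy => by rw [Finset.mem_singleton.1 hy, hx]) U
  have h1 := hU.integral_integral_localGibbs m (hμ.2 {x}) hf
  have h2 := hU.integral_integral_localGibbs m' (hν.2 {x}) hf
  rw [← hK] at h2
  have hle : ∀ w, ((if w = x then 0 else δ w + c w * δ x : ℝ≥0) : ℝ≥0∞) ≤ δ w + c w * δ x := by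
    intro w
    split_ifs
    · simp
    · push_cast
      exact le_rfl
  have hfin : ∑' w, ((if w = x then 0 else δ w + c w * δ x : ℝ≥0) : ℝ≥0∞) ≠ ∞ := by
    refine ne_top_of_le_ne_top ?_ (ENNReal.tsum_le_tsum hle)
    rw [ENNReal.tsum_add, ENNReal.tsum_mul_right]
    exact ENNReal.add_ne_top.2 ⟨hsum, ENNReal.mul_ne_top hcsum ENNReal.coe_ne_top⟩
  have key := ha _ _ (hU.continuous_integral_localGibbs m {x} hf) hδ' hfin
  rw [h1, h2] at key
  refine key.trans ?_
  rw [ENNReal.tsum_eq_add_tsum_ite (f := fun z => Function.update a x (∑' w, c w * a w) z * δ z) x]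
  simp only [update_self]
  rw [← ENNReal.tsum_mul_right, ← ENNReal.tsum_add]
  refine ENNReal.tsum_le_tsum fun w => ?_
  by_cases hw : w = x
  · simp [hw]
  · simp only [hw, if_false, update_of_ne hw]
    push_cast
    rw [mul_add, add_comm]
    refine add_le_add (le_of_eq ?_) le_rfl
    ring

/-- Sites are updated one after the other along a finite set F. Earlier updates only lower the
weights, so each new one is still at most b. Outside F the weights are at most M, and M times the
tail of the summable δ vanishes as F grows. -/
theorem IsEstimate.sweep {E : V → Set X} {μ ν : Measure (V → X)} {c : V → V → ℝ≥0∞} {D : Set V}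
    (hupd : ∀ x ∉ D, ∀ a, IsEstimate E μ ν a →
      IsEstimate E μ ν (Function.update a x (∑' w, c x w * a w)))
    {a b : V → ℝ≥0∞} {M : ℝ≥0∞} (hM : M ≠ ∞) (haM : ∀ z, a z ≤ M) (hba : ∀ z, b z ≤ a z)
    (hD : ∀ z ∈ D, a z = b z) (hb : ∀ x ∉ D, ∑' w, c x w * a w ≤ b x)
    (ha : IsEstimate E μ ν a) : IsEstimate E μ ν b := by
  have hF : ∀ F : Finset V, IsEstimate E μ ν fun z => if z ∈ F then b z else a z := by
    intro F
    induction F using Finset.induction with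
    | empty => simpa using ha
    | insert x F hx ih =>
      by_cases hxD : x ∈ D
      · refine ih.mono fun z => ?_
        by_cases hzx : z = x
        · subst hzx
          simp [hx, hD z hxD]
        · simp [hzx]
      · refine (hupd x hxD _ ih).mono fun z => ?_
        by_cases hzx : z = x
        · subst hzx
          simp only [update_self, Finset.mem_insert_self, if_true]
          refine (ENNReal.tsum_le_tsum fun w => ?_).trans (hb z hxD)
          refine mul_le_mul_right ?_ _
          split_ifs
          · exact hba w
          · exact le_rfl
        · simp [hzx]
  intro f δ hf hδ hsum
  have htail := ENNReal.tendsto_tsum_compl_atTop_zero (f := fun z => (δ z : ℝ≥0∞)) hsum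
  have htail' := (ENNReal.Tendsto.const_mul htail (Or.inr hM)).const_add (∑' z, b z * δ z)
  rw [mul_zero, add_zero] at htail'
  refine ge_of_tendsto' htail' fun F => (hF F f δ hf hδ hsum).trans ?_
  have h0 : ∑' z : {z // z ∉ F}, (δ z : ℝ≥0∞) =
      ∑' z, if z ∈ F then 0 else (δ z : ℝ≥0∞) := by
    refine (tsum_subtype {z | z ∉ F} fun z => (δ z : ℝ≥0∞)).trans (tsum_congr fun z => ?_)
    by_cases hz : z ∈ F <;> simp [hz]
  rw [h0, ← ENNReal.tsum_mul_left, ← ENNReal.tsum_add]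
  refine ENNReal.tsum_le_tsum fun z => ?_
  by_cases hz : z ∈ F
  · simp [hz]
  · simp only [hz, if_false]
    exact (mul_le_mul_left (haM z) _).trans (le_add_left le_rfl)

/-- Iterating the sweep: a bounded supersolution of the estimate equation is an estimate. -/
theorem IsEstimate.of_supersolution {E : V → Set X} {μ ν : Measure (V → X)} {c : V → V → ℝ≥0∞}
    {D : Set V} (hupd : ∀ x ∉ D, ∀ a, IsEstimate E μ ν a →
      IsEstimate E μ ν (Function.update a x (∑' w, c x w * a w)))
    (h1 : IsEstimate E μ ν fun _ => 1) {κ M : ℝ≥0∞} (hκ : κ < 1) (hM : M ≠ ∞) {a : V → ℝ≥0∞}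
    (haM : ∀ z, a z ≤ M) (hrow : ∀ x ∉ D, ∑' w, (if w ∈ D then 0 else c x w) ≤ κ)
    (ha : ∀ x ∉ D, ∑' w, (if w ∈ D then c x w else c x w * a w) ≤ a x) :
    IsEstimate E μ ν fun z => if z ∈ D then 1 else a z := by
  -- Off D, a surplus t over the supersolution shrinks by κ in one sweep; on D, where no update is
  -- available, the weight stays one. The surplus 1 already dominates the trivial estimate.
  have hstep : ∀ t : ℝ≥0∞, t ≤ 1 → (IsEstimate E μ ν fun z => if z ∈ D then 1 else a z + t) →
      IsEstimate E μ ν fun z => if z ∈ D then 1 else a z + κ * t := by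
    intro t ht h
    refine h.sweep hupd (M := M + 1) (by simp [hM]) (fun z => ?_) (fun z => ?_) (fun z hz => ?_)
      fun x hx => ?_
    · split_ifs
      · exact le_add_left le_rfl
      · exact add_le_add (haM z) ht
    · split_ifs
      · exact le_rfl
      · exact add_le_add le_rfl (mul_le_of_le_one_left (zero_le) hκ.le)
    · simp [hz]
    · simp only [hx, if_false]
      calc ∑' w, c x w * (if w ∈ D then 1 else a w + t)
          = ∑' w, ((if w ∈ D then c x w else c x w * a w) +
              (if w ∈ D then 0 else c x w) * t) := by
            refine tsum_congr fun w => ?_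
            split_ifs
            · simp
            · ring
        _ ≤ a x + κ * t := by
            rw [ENNReal.tsum_add, ENNReal.tsum_mul_right]
            exact add_le_add (ha x hx) (mul_le_mul_left (hrow x hx) _)
  have hn : ∀ n : ℕ, IsEstimate E μ ν fun z => if z ∈ D then 1 else a z + κ ^ n := by
    intro n
    induction n with
    | zero =>
      refine h1.mono fun z => ?_
      split_ifs
      · exact le_rfl
      · simp
    | succ n ih =>
      have := hstep _ (pow_le_one₀ (zero_le) hκ.le) ih
      simpa only [pow_succ'] using this
  intro f δ hf hδ hsum
  have hlim := (ENNReal.Tendsto.mul_const (ENNReal.tendsto_pow_atTop_nhds_zero_of_lt_one hκ)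
    (Or.inr hsum)).const_add (∑' z, (if z ∈ D then 1 else a z) * (δ z : ℝ≥0∞))
  rw [zero_mul, add_zero] at hlim
  refine ge_of_tendsto' hlim fun n => (hn n f δ hf hδ hsum).trans ?_
  rw [← ENNReal.tsum_mul_left, ← ENNReal.tsum_add]
  refine ENNReal.tsum_le_tsum fun z => ?_
  dsimp only
  split_ifs
  · exact le_add_right le_rfl
  · rw [add_mul]

/-- The `n`-fold application of the matrix `C` to the matrix `B`. -/
noncomputable def greenIter (C B : V → V → ℝ≥0∞) : ℕ → V → V → ℝ≥0∞
  | 0 => B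
  | n + 1 => fun z y => ∑' w, C z w * greenIter C B n w y

/-- The solution `G = ∑ Cⁿ B` of `G = B + C G`. -/
noncomputable def green (C B : V → V → ℝ≥0∞) (z y : V) : ℝ≥0∞ :=
  ∑' n, greenIter C B n z y

theorem green_eq (C B : V → V → ℝ≥0∞) (z y : V) :
    green C B z y = B z y + ∑' w, C z w * green C B w y := by
  rw [green, tsum_eq_zero_add' ENNReal.summable]
  congr 1
  simp_rw [green, ← ENNReal.tsum_mul_left]
  rw [ENNReal.tsum_comm]
  rfl

theorem tsum_greenIter_le {C B : V → V → ℝ≥0∞} {κ b : ℝ≥0∞} (hC : ∀ z, ∑' w, C z w ≤ κ)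
    (hB : ∀ z, ∑' w, B z w ≤ b) (n : ℕ) (z : V) : ∑' y, greenIter C B n z y ≤ κ ^ n * b := by
  induction n generalizing z with
  | zero => simpa [greenIter] using hB z
  | succ n ih =>
    simp only [greenIter]
    rw [ENNReal.tsum_comm]
    simp_rw [ENNReal.tsum_mul_left]
    calc ∑' w, C z w * ∑' y, greenIter C B n w y ≤ ∑' w, C z w * (κ ^ n * b) :=
          ENNReal.tsum_le_tsum fun w => mul_le_mul_right (ih w) _
      _ ≤ κ ^ (n + 1) * b := by
          rw [ENNReal.tsum_mul_right, pow_succ', mul_assoc]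
          exact mul_le_mul_left (hC z) _

/-- Neumann series: the rows of Cⁿ B sum to at most κⁿ b. -/
theorem tsum_green_le {C B : V → V → ℝ≥0∞} {κ b : ℝ≥0∞} (hC : ∀ z, ∑' w, C z w ≤ κ)
    (hB : ∀ z, ∑' w, B z w ≤ b) (z : V) : ∑' y, green C B z y ≤ (1 - κ)⁻¹ * b := by
  simp only [green]
  rw [ENNReal.tsum_comm, ← ENNReal.tsum_geometric, ← ENNReal.tsum_mul_right]
  exact ENNReal.tsum_le_tsum fun n => tsum_greenIter_le hC hB n z

/-- Dobrushin's comparison theorem for Gibbs measures with the same energy and with a priori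
measures that agree off `D`. -/
theorem IsEnergy.abs_integral_sub_le (hU : IsEnergy U) {E : V → Set X} {μ ν : Measure (V → X)}
    (hμ : IsLocalGibbs m U μ) (hν : IsLocalGibbs m' U ν) (hEm : ∀ x, MeasurableSet (E x))
    (hE : ∀ x, ∀ᵐ s ∂(m x), s ∈ E x) (hE' : ∀ x, ∀ᵐ s ∂(m' x), s ∈ E x)
    {D : Set V} (hD : ∀ x ∉ D, m x = m' x) {C B : V → V → ℝ≥0} {κ b : ℝ≥0∞} (hκ : κ < 1)
    (hb : b ≠ ∞) (hC : ∀ z, ∑' w, (C z w : ℝ≥0∞) ≤ κ) (hB : ∀ z, ∑' w, (B z w : ℝ≥0∞) ≤ b)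
    (hosc : ∀ x ∉ D, ∀ w, w ≠ x → ∀ η ζ : V → X, (∀ y, η y ∈ E y) → (∀ y, ζ y ∈ E y) →
      (∀ y, y ≠ w → η y = ζ y) → ∀ s t : X,
        (U {x} (update η x s) - U {x} (update ζ x s)) -
          (U {x} (update η x t) - U {x} (update ζ x t)) ≤
            4 * (if w ∈ D then B x w else C x w : ℝ≥0))
    {f : (V → X) → ℝ} (hf : Continuous f) {δ : V → ℝ≥0} (hδ : OscBound E f δ)
    (hsum : ∑' z, (δ z : ℝ≥0∞) ≠ ∞) :
    ENNReal.ofReal |(∫ ω, f ω ∂μ) - ∫ ω, f ω ∂ν| ≤ ∑' y : D, ((δ y : ℝ≥0∞) +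
      ∑' z, green (fun z w => (C z w : ℝ≥0∞)) (fun z w => (B z w : ℝ≥0∞)) z y * δ z) := by
  set G := green (fun z w => (C z w : ℝ≥0∞)) (fun z w => (B z w : ℝ≥0∞)) with hG
  have := hμ.1
  have := hν.1
  have h1 : IsEstimate E μ ν fun _ => 1 :=
    isEstimate_one (hU.ae_mem_of_isLocalGibbs m hμ hEm hE)
      (hU.ae_mem_of_isLocalGibbs m' hν hEm hE')
  have hrow : ∀ x, ∑' w, ((if w ∈ D then B x w else C x w : ℝ≥0) : ℝ≥0∞) ≠ ∞ := by
    intro x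
    refine ne_top_of_le_ne_top (ENNReal.add_ne_top.2 ⟨hb, hκ.ne_top⟩)
      (le_trans ?_ (add_le_add (hB x) (hC x)))
    rw [← ENNReal.tsum_add]
    refine ENNReal.tsum_le_tsum fun w => ?_
    split_ifs
    · exact le_add_right le_rfl
    · exact le_add_left le_rfl
  -- The supersolution at z is the total influence of D on z, the sum of `G z y` over y in D; the
  -- equation G = B + C G verifies it, the term B coming from the weight one on D.
  have hest := IsEstimate.of_supersolution (E := E) (μ := μ) (ν := ν)
    (c := fun x w => ((if w ∈ D then B x w else C x w : ℝ≥0) : ℝ≥0∞)) (D := D)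
    (fun x hx a ha => ha.update hU hμ hν hE (hD x hx) (hrow x) (hosc x hx))
    h1 hκ (M := (1 - κ)⁻¹ * b)
    (ENNReal.mul_ne_top (ENNReal.inv_ne_top.2 (tsub_pos_of_lt hκ).ne') hb)
    (a := fun z => ∑' y : D, G z y)
    (fun z => (ENNReal.tsum_comp_le_tsum_of_injective Subtype.val_injective _).trans
      (tsum_green_le hC hB z))
    (fun x _ => by
      refine le_trans (ENNReal.tsum_le_tsum fun w => ?_) (hC x)
      split_ifs <;> simp)
    (fun x _ => by
      calc ∑' w, (if w ∈ D then ((if w ∈ D then B x w else C x w : ℝ≥0) : ℝ≥0∞)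
            else ((if w ∈ D then B x w else C x w : ℝ≥0) : ℝ≥0∞) * ∑' y : D, G w y)
          ≤ ∑' w, (D.indicator (fun w => (B x w : ℝ≥0∞)) w + C x w * ∑' y : D, G w y) := by
            refine ENNReal.tsum_le_tsum fun w => ?_
            by_cases hw : w ∈ D
            · simp only [hw, if_true, Set.indicator_of_mem]
              exact le_add_right le_rfl
            · simp [hw]
        _ = ∑' y : D, G x y := by
            rw [ENNReal.tsum_add, ← tsum_subtype]
            simp_rw [← ENNReal.tsum_mul_left]
            rw [ENNReal.tsum_comm, ← ENNReal.tsum_add]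
            exact tsum_congr fun y => (green_eq (fun z w => (C z w : ℝ≥0∞)) (fun z w => (B z w : ℝ≥0∞)) x y).symm)
  refine (hest f δ hf hδ hsum).trans ?_
  rw [ENNReal.tsum_add, ENNReal.tsum_comm, tsum_subtype D fun z => (δ z : ℝ≥0∞), ← ENNReal.tsum_add]
  refine ENNReal.tsum_le_tsum fun z => ?_
  rw [ENNReal.tsum_mul_right]
  by_cases hz : z ∈ D
  · simp [hz]
  · simp [hz]

/-- Finite-dimensional marginals determine the measure. Observables of finitely many spins have
finitely many nonzero oscillations, so the comparison theorem applies to them. -/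
theorem ext_of_forall_integral_finset_restrict {μ ν : Measure (V → X)} [IsProbabilityMeasure μ]
    [IsProbabilityMeasure ν] (h : ∀ (F : Finset V) (g : (F → X) → ℝ), Continuous g →
      ∫ ω, g (F.restrict ω) ∂μ = ∫ ω, g (F.restrict ω) ∂ν) : μ = ν := by
  have hF : ∀ F : Finset V, ν.map F.restrict = μ.map F.restrict := by
    intro F
    have := Measure.isProbabilityMeasure_map (μ := μ) (Finset.measurable_restrict F).aemeasurable
    have := Measure.isProbabilityMeasure_map (μ := ν) (Finset.measurable_restrict F).aemeasurable
    refine ext_of_forall_integral_eq_of_IsFiniteMeasure fun g => ?_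
    rw [integral_map (Finset.measurable_restrict F).aemeasurable
        g.continuous.measurable.aestronglyMeasurable,
      integral_map (Finset.measurable_restrict F).aemeasurable
        g.continuous.measurable.aestronglyMeasurable]
    exact (h F g g.continuous).symm
  have hp : ∀ F : Finset V, IsProbabilityMeasure (μ.map F.restrict) := fun F =>
    Measure.isProbabilityMeasure_map (Finset.measurable_restrict F).aemeasurable
  exact IsProjectiveLimit.unique (P := fun F : Finset V => μ.map F.restrict) (fun F => rfl) hF

/-- Dobrushin's uniqueness theorem. -/
theorem IsEnergy.isLocalGibbs_unique (hU : IsEnergy U) {E : V → Set X} {μ ν : Measure (V → X)}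
    (hμ : IsLocalGibbs m U μ) (hν : IsLocalGibbs m U ν) (hEm : ∀ x, MeasurableSet (E x))
    (hE : ∀ x, ∀ᵐ s ∂(m x), s ∈ E x) {C : V → V → ℝ≥0} {κ : ℝ≥0∞} (hκ : κ < 1)
    (hC : ∀ z, ∑' w, (C z w : ℝ≥0∞) ≤ κ)
    (hosc : ∀ x w, w ≠ x → ∀ η ζ : V → X, (∀ y, η y ∈ E y) → (∀ y, ζ y ∈ E y) →
      (∀ y, y ≠ w → η y = ζ y) → ∀ s t : X,
        (U {x} (update η x s) - U {x} (update ζ x s)) -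
          (U {x} (update η x t) - U {x} (update ζ x t)) ≤ 4 * C x w) : μ = ν := by
  have := hμ.1
  have := hν.1
  refine ext_of_forall_integral_finset_restrict fun F g hg => ?_
  have hgF : Continuous fun ω : V → X => g (F.restrict ω) := hg.comp (Finset.continuous_restrict F)
  obtain ⟨K, hK⟩ := exists_abs_le_of_continuous hg
  have hδ : OscBound E (fun ω : V → X => g (F.restrict ω))
      fun z => if z ∈ F then (2 * K).toNNReal else 0 := by
    intro z η ζ _ _ hag
    by_cases hz : z ∈ F
    · simp only [hz, if_true]
      refine le_trans ?_ (Real.le_coe_toNNReal _)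
      have h1 := hK (F.restrict η)
      have h2 := hK (F.restrict ζ)
      exact (abs_sub _ _).trans (by linarith)
    · have : F.restrict η = F.restrict ζ :=
        funext fun y => hag y fun h => hz (h ▸ y.2)
      simp [this, hz]
  have key := hU.abs_integral_sub_le hμ hν hEm hE hE (D := ∅) (fun _ _ => rfl) (C := C)
    (B := fun _ _ => 0) hκ (b := 0) (by simp) hC (by simp)
    (fun x _ w hw η ζ hη hζ hag s t => by simpa using hosc x w hw η ζ hη hζ hag s t) hgF hδ (by
      rw [tsum_eq_sum (s := F) fun z hz => by simp [hz]]
      exact ENNReal.sum_ne_top.2 fun _ _ => ENNReal.coe_ne_top)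
  rw [tsum_empty, nonpos_iff_eq_zero, ENNReal.ofReal_eq_zero] at key
  exact sub_eq_zero.1 (abs_nonpos_iff.1 key)

end Comparison

open Function Filter Topology
open scoped NNReal

/-! ### Conditioning a finite-volume distribution on a product event -/

section Cond

variable {V X : Type*} [DecidableEq V] [Countable V] [TopologicalSpace X] [CompactSpace X]
  [T2Space X] [SecondCountableTopology X] [MeasurableSpace X] [BorelSpace X]
  {U : Finset V → (V → X) → ℝ}

/-- Conditioning normalises afresh, so the partition function of the unconstrained distribution
drops out. -/
theorem cond_smul_of_ne {Ω : Type*} [MeasurableSpace Ω] (μ : Measure Ω) {c : ℝ≥0∞} (h0 : c ≠ 0)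
    (ht : c ≠ ∞) (s : Set Ω) :
    ProbabilityTheory.cond (c • μ) s = (μ s)⁻¹ • μ.restrict s := by
  rw [ProbabilityTheory.cond, Measure.restrict_smul, Measure.smul_apply, smul_smul, smul_eq_mul,
    ENNReal.mul_inv (Or.inl h0) (Or.inl ht), mul_right_comm, ENNReal.inv_mul_cancel h0 ht, one_mul]

theorem IsEnergy.map_withDensity_univ (hU : IsEnergy U) (m : V → Measure X)
    [∀ x, IsFiniteMeasure (m x)] [∀ x, NeZero (m x)] (Λ : Finset V) (η : V → X) :
    (((Measure.pi fun x : Λ => m x).withDensity fun ζ =>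
      ENNReal.ofReal (Real.exp (U Λ (updateFinset η Λ ζ)))).map (updateFinset η Λ)) Set.univ =
        ENNReal.ofReal
          (∫ ζ, Real.exp (U Λ (updateFinset η Λ ζ)) ∂(Measure.pi fun x : Λ => m x)) := by
  have hm : Measurable (updateFinset η Λ : (Λ → X) → V → X) := measurable_updateFinset
  rw [Measure.map_apply hm MeasurableSet.univ, Set.preimage_univ,
    withDensity_apply _ MeasurableSet.univ, Measure.restrict_univ]
  exact (ofReal_integral_eq_lintegral_ofReal (hU.integrable_exp m Λ η)
    (ae_of_all _ fun _ => (Real.exp_pos _).le)).symm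

/-- Conditioning a finite-volume Gibbs distribution on a product event in the volume restricts
the a priori measures. -/
theorem IsEnergy.cond_eq_localGibbs (hU : IsEnergy U) (ν : Measure X) [IsFiniteMeasure ν]
    [NeZero ν] {A : V → Set X} (hA : ∀ x, MeasurableSet (A x)) (hA0 : ∀ x, ν (A x) ≠ 0) (Λ : Finset V)
    (η : V → X) :
    ProbabilityTheory.cond
      (((((Measure.pi fun _ : Λ => ν).withDensity fun ζ =>
        ENNReal.ofReal (Real.exp (U Λ (updateFinset η Λ ζ)))).map
          fun ζ => updateFinset η Λ ζ) Set.univ)⁻¹ •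
      ((Measure.pi fun _ : Λ => ν).withDensity fun ζ =>
        ENNReal.ofReal (Real.exp (U Λ (updateFinset η Λ ζ)))).map fun ζ => updateFinset η Λ ζ)
      {ω | ∀ x ∈ Λ, ω x ∈ A x} = localGibbs (fun x => ν.restrict (A x)) U Λ η := by
  have (x : V) : NeZero (ν.restrict (A x)) := ⟨fun h => hA0 x (Measure.restrict_eq_zero.1 h)⟩
  have hdens : Measurable fun ζ => ENNReal.ofReal (Real.exp (U Λ (updateFinset η Λ ζ))) :=
    (hU.continuous_updateFinset Λ η).measurable.exp.ennreal_ofReal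
  have hcyl : MeasurableSet {ω : V → X | ∀ x ∈ Λ, ω x ∈ A x} := by
    have : {ω : V → X | ∀ x ∈ Λ, ω x ∈ A x} = ⋂ x ∈ Λ, {ω : V → X | ω x ∈ A x} := by
      ext ω
      simp
    rw [this]
    exact Finset.measurableSet_biInter Λ fun x _ => (hA x).preimage (measurable_pi_apply x)
  have hpre : updateFinset η Λ ⁻¹' {ω : V → X | ∀ x ∈ Λ, ω x ∈ A x} =
      Set.univ.pi fun x : Λ => A x := by
    ext ζ
    simp only [Set.mem_preimage, Set.mem_ofPred_eq, Set.mem_pi, Set.mem_univ, true_imp_iff]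
    refine Iff.trans (forall₂_congr fun x hx => ?_) Subtype.forall.symm
    simp [updateFinset, hx]
  set W := ((Measure.pi fun _ : Λ => ν).withDensity fun ζ =>
    ENNReal.ofReal (Real.exp (U Λ (updateFinset η Λ ζ)))).map (updateFinset η Λ) with hW
  have hres : W.restrict {ω : V → X | ∀ x ∈ Λ, ω x ∈ A x} =
      ((Measure.pi fun x : Λ => ν.restrict (A x)).withDensity
        fun ζ => ENNReal.ofReal (Real.exp (U Λ (updateFinset η Λ ζ)))).map (updateFinset η Λ) := by
    rw [hW, Measure.restrict_map measurable_updateFinset hcyl,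
      restrict_withDensity (measurable_updateFinset hcyl), hpre, Measure.restrict_pi_pi]
  have hvol : W Set.univ = _ := hU.map_withDensity_univ (fun _ => ν) Λ η
  have := neZero_pi (fun x => ν.restrict (A x)) Λ
  have := neZero_pi (fun _ : V => ν) Λ
  have hZ := integral_exp_pos (hU.integrable_exp (fun x => ν.restrict (A x)) Λ η)
  refine (cond_smul_of_ne W ?_ ?_ _).trans ?_
  · rw [hvol]
    exact ENNReal.inv_ne_zero.2 ENNReal.ofReal_ne_top
  · rw [hvol]
    exact ENNReal.inv_ne_top.2
      (ENNReal.ofReal_pos.2 (integral_exp_pos (hU.integrable_exp (fun _ => ν) Λ η))).ne'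
  · rw [← Measure.restrict_apply_univ, hres, hU.map_withDensity_univ (fun x => ν.restrict (A x)) Λ η,
      localGibbs, Measure.tilted, ← Measure.map_smul, ← withDensity_smul _ hdens]
    congr 2
    ext ζ
    simp only [Pi.smul_apply, smul_eq_mul]
    rw [div_eq_mul_inv, ENNReal.ofReal_mul (Real.exp_pos _).le, mul_comm,
      ENNReal.ofReal_inv_of_pos hZ]

end Cond

/-! ### Arcs of the circle and the scalar product of spins -/

section Circle

theorem continuous_spinDot : Continuous fun p : Spin × Spin => spinDot p.1 p.2 := by
  unfold spinDot
  have h : Continuous fun θ : Spin => ((AddCircle.toCircle θ : Circle) : ℂ) :=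
    continuous_subtype_val.comp AddCircle.continuous_toCircle
  exact Continuous.inner (h.comp continuous_fst) (h.comp continuous_snd)

theorem abs_spinDot_le_one (θ φ : Spin) : |spinDot θ φ| ≤ 1 := by
  refine (abs_real_inner_le_norm _ _).trans ?_
  rw [Circle.norm_coe, Circle.norm_coe, one_mul]

theorem coe_angle (θ : Spin) : ((angle θ : ℝ) : Spin) = θ :=
  AddCircle.coe_equivIco

theorem spinDot_comm (θ φ : Spin) : spinDot θ φ = spinDot φ θ :=
  real_inner_comm _ _

theorem spinDot_eq_cos (θ φ : Spin) : spinDot θ φ = Real.cos (angle θ - angle φ) := by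
  rw [← spinDot_coe, coe_angle, coe_angle]

theorem measurable_angle : Measurable angle :=
  measurable_subtype_coe.comp (AddCircle.measurableEquivIco (2 * Real.pi) 0).measurable

theorem angle_coe {a : ℝ} (ha : a ∈ Set.Ico 0 (2 * Real.pi)) : angle (a : Spin) = a := by
  have ha' : a ∈ Set.Ico 0 (0 + 2 * Real.pi) := by simpa using ha
  rw [angle, AddCircle.equivIco_coe_eq ha']

variable (q : ℕ) [NeZero q]

theorem measurable_coarse : Measurable (coarse q) := by
  refine measurable_to_countable' fun k => ?_
  have h : Measurable fun θ : Spin => ⌊q * angle θ / (2 * Real.pi)⌋₊ :=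
    Nat.measurable_floor.comp ((measurable_angle.const_mul _).div_const _)
  have : coarse q ⁻¹' {k} = {θ : Spin | ⌊q * angle θ / (2 * Real.pi)⌋₊ = k} := by
    ext θ
    simp [coarse, Fin.ext_iff]
  rw [this]
  exact measurableSet_eq_fun h measurable_const

theorem measurableSet_arc (k : Fin q) : MeasurableSet {θ : Spin | coarse q θ = k} :=
  measurable_coarse q (measurableSet_singleton k)

/-- The arc contains the image of an open interval, which is open and nonempty. -/
theorem volume_arc_ne_zero (k : Fin q) : volume {θ : Spin | coarse q θ = k} ≠ 0 := by
  have hq : (0 : ℝ) < q := Nat.cast_pos.mpr (NeZero.pos q)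
  have hpi := Real.two_pi_pos
  have hlt : 2 * Real.pi * k / q < 2 * Real.pi * (k + 1) / q := by
    gcongr
    linarith
  have hopen : IsOpen ((fun a : ℝ => (a : Spin)) ''
      Set.Ioo (2 * Real.pi * k / q) (2 * Real.pi * (k + 1) / q)) :=
    QuotientAddGroup.isOpenMap_coe _ isOpen_Ioo
  have hpos := hopen.measure_pos volume ((Set.nonempty_Ioo.2 hlt).image _)
  refine (hpos.trans_le (measure_mono ?_)).ne'
  rintro _ ⟨a, ha, rfl⟩
  have hk : ((k : ℕ) : ℝ) + 1 ≤ q := by exact_mod_cast k.2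
  have ha0 : 0 ≤ a := le_trans (by positivity) ha.1.le
  have ha1 : a < 2 * Real.pi := ha.2.trans_le (by
    rw [div_le_iff₀ hq]
    exact mul_le_mul_of_nonneg_left hk hpi.le)
  refine Fin.ext ?_
  simp only [coarse, angle_coe ⟨ha0, ha1⟩]
  rw [Nat.floor_eq_iff (by positivity), le_div_iff₀ hpi, div_lt_iff₀ hpi]
  have h1 := (div_lt_iff₀ hq).1 ha.1
  have h2 := (lt_div_iff₀ hq).1 ha.2
  constructor <;> nlinarith

theorem abs_angle_sub_angle_le {θ φ : Spin} (h : coarse q θ = coarse q φ) :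
    |angle θ - angle φ| ≤ 2 * Real.pi / q := by
  have hq : (0 : ℝ) < q := Nat.cast_pos.mpr (NeZero.pos q)
  have hpi := Real.two_pi_pos
  have hfl : ⌊q * angle θ / (2 * Real.pi)⌋₊ = ⌊q * angle φ / (2 * Real.pi)⌋₊ := Fin.ext_iff.1 h
  have bound : ∀ ψ : Spin, (⌊q * angle ψ / (2 * Real.pi)⌋₊ : ℝ) * (2 * Real.pi) ≤ q * angle ψ ∧
      q * angle ψ < (⌊q * angle ψ / (2 * Real.pi)⌋₊ + 1) * (2 * Real.pi) := fun ψ =>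
    ⟨(le_div_iff₀ hpi).1 (Nat.floor_le (div_nonneg (mul_nonneg hq.le (angle_nonneg ψ)) hpi.le)),
      (div_lt_iff₀ hpi).1 (Nat.lt_floor_add_one _)⟩
  have h1 := bound θ
  have h2 := bound φ
  rw [hfl] at h1
  rw [le_div_iff₀ hq, show |angle θ - angle φ| * q = |(angle θ - angle φ) * q| by
    rw [abs_mul, abs_of_pos hq]]
  exact abs_le.2 ⟨by linarith, by linarith⟩

/-- The scalar product is the cosine of the difference of angles, and the cosine is 1-Lipschitz;
here the arc length enters the estimates. -/
theorem abs_spinDot_sub_le {θ φ : Spin} (h : coarse q θ = coarse q φ) (s : Spin) :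
    |spinDot s θ - spinDot s φ| ≤ 2 * Real.pi / q := by
  rw [spinDot_eq_cos, spinDot_eq_cos]
  refine (Real.abs_cos_sub_cos_le _ _).trans ?_
  rw [show angle s - angle θ - (angle s - angle φ) = -(angle θ - angle φ) by ring, abs_neg]
  exact abs_angle_sub_angle_le q h

/-- Lebesgue measure on the arc with label `k`. -/
noncomputable def arcMeasure (k : Fin q) : Measure Spin :=
  volume.restrict {θ : Spin | coarse q θ = k}

instance isFiniteMeasure_arcMeasure (k : Fin q) : IsFiniteMeasure (arcMeasure q k) :=
  inferInstanceAs (IsFiniteMeasure (volume.restrict _))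

instance neZero_arcMeasure (k : Fin q) : NeZero (arcMeasure q k) :=
  ⟨fun h => volume_arc_ne_zero q k (Measure.restrict_eq_zero.1 h)⟩

theorem ae_arcMeasure (k : Fin q) : ∀ᵐ s ∂(arcMeasure q k), coarse q s = k :=
  ae_restrict_mem (measurableSet_arc q k)

end Circle

/-! ### Summability of the couplings -/

section Coupling

variable {d : ℕ} {α : ℝ}

theorem siteNorm_nonneg (x : Site d) : 0 ≤ siteNorm x := Real.sqrt_nonneg _

theorem siteNorm_neg (x : Site d) : siteNorm (-x) = siteNorm x := by
  simp [siteNorm]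

/-- The integer points form the lattice spanned by the standard basis of Euclidean space, and
lattice sums with exponent below minus the rank converge. -/
theorem summable_siteNorm_rpow (hα : (d : ℝ) < α) :
    Summable fun x : Site d => siteNorm x ^ (-α) := by
  let b := (EuclideanSpace.basisFun (Fin d) ℝ).toBasis
  let L := Submodule.span ℤ (Set.range b)
  have hrank : Module.finrank ℤ L = d := by
    rw [ZLattice.rank ℝ L]
    simp
  have hs := ZLattice.summable_norm_rpow L (-α) (by rw [hrank]; linarith)
  have hmem : ∀ x : Site d, (WithLp.toLp 2 fun i => (x i : ℝ)) ∈ L := by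
    intro x
    have : (WithLp.toLp 2 fun i => (x i : ℝ)) = ∑ i, x i • b i := by
      ext j
      simp [b, Finset.sum_apply, Pi.single_apply]
    rw [this]
    exact Submodule.sum_mem _ fun i _ => Submodule.smul_mem _ _ (Submodule.subset_span ⟨i, rfl⟩)
  have hinj : Function.Injective fun x : Site d => (⟨_, hmem x⟩ : L) := by
    intro x y hxy
    ext i
    have := congrFun (congrArg (WithLp.ofLp) (Subtype.ext_iff.1 hxy)) i
    simpa using this
  refine (hs.comp_injective hinj).congr fun x => ?_
  simp [siteNorm, EuclideanSpace.norm_eq]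

/-- The strength of the interaction of two sites. -/
noncomputable def coupling (α : ℝ) (x y : Site d) : ℝ≥0 :=
  ⟨siteNorm (x - y) ^ (-α), Real.rpow_nonneg (siteNorm_nonneg _) _⟩

theorem coe_coupling (x y : Site d) : (coupling α x y : ℝ) = siteNorm (x - y) ^ (-α) := rfl

theorem coupling_comm (x y : Site d) : coupling α x y = coupling α y x := by
  ext
  rw [coe_coupling, coe_coupling, ← neg_sub, siteNorm_neg]

theorem tsum_coupling_le (hα : (d : ℝ) < α) {S : Set (Site d)} (z : Site d) :
    ∑' w : S, (coupling α z w : ℝ≥0∞) ≤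
      ENNReal.ofReal (∑' x : {x : Site d // x ≠ 0}, siteNorm x.1 ^ (-α)) := by
  have hs := summable_siteNorm_rpow hα
  have hα0 : 0 < α := (Nat.cast_nonneg d).trans_lt hα
  -- The origin contributes nothing because a real power of zero with nonzero exponent is zero. For
  -- the same reason the diagonal coupling vanishes and later row sums may include it.
  have h0 : ∑' x : {x : Site d // x ≠ 0}, siteNorm x.1 ^ (-α) =
      ∑' x : Site d, siteNorm x ^ (-α) := by
    refine tsum_subtype_eq_of_support_subset (f := fun x : Site d => siteNorm x ^ (-α))
      (s := {x : Site d | x ≠ 0}) ?_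
    intro x hx h
    have hx0 : x = 0 := by simpa using h
    refine hx ?_
    rw [hx0]
    simp [siteNorm, Real.zero_rpow (neg_ne_zero.2 hα0.ne')]
  rw [h0, ENNReal.ofReal_tsum_of_nonneg (fun x => Real.rpow_nonneg (siteNorm_nonneg _) _) hs]
  have hinj : Function.Injective fun w : S => z - w.1 := fun a b h =>
    Subtype.ext (sub_right_injective h)
  refine le_trans (le_of_eq (tsum_congr fun w => ?_))
    (ENNReal.tsum_comp_le_tsum_of_injective hinj fun x => ENNReal.ofReal (siteNorm x ^ (-α)))
  rw [← coe_coupling, ENNReal.ofReal_coe_nnreal]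

theorem summable_coupling (hα : (d : ℝ) < α) {S : Set (Site d)} (z : Site d) :
    Summable fun w : S => (coupling α z w : ℝ) :=
  NNReal.summable_coe.2 (ENNReal.tsum_coe_ne_top_iff_summable.1
    (ne_top_of_le_ne_top ENNReal.ofReal_ne_top (tsum_coupling_le hα z)))

end Coupling

/-! ### Convergence and locality of the Hamiltonian -/

section Hamiltonian

variable {d : ℕ} {α : ℝ} {S : Set (Site d)}

theorem sum_offDiag_pair {V M : Type*} [DecidableEq V] [AddCommMonoid M] {x y : V} (h : x ≠ y) (F : V × V → M) :
    ∑ p ∈ ({x, y} : Finset V).offDiag, F p = F (x, y) + F (y, x) := by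
  have : ({x, y} : Finset V).offDiag = {(x, y), (y, x)} := by
    ext ⟨a, b⟩
    simp only [Finset.mem_offDiag, Finset.mem_insert, Finset.mem_singleton, Prod.mk.injEq]
    constructor
    · rintro ⟨rfl | rfl, rfl | rfl, hab⟩ <;> simp_all
    · rintro (⟨rfl, rfl⟩ | ⟨rfl, rfl⟩) <;> simp [h, h.symm]
  rw [this, Finset.sum_pair]
  simp [h]

theorem potential_pair {x y : S} (h : x ≠ y) (ω : Config S) :
    potential α {x, y} ω = coupling α x.1 y.1 * spinDot (ω x) (ω y) := by
  rw [potential, if_pos (Finset.card_pair h), sum_offDiag_pair h, ← coe_coupling, ← coe_coupling,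
    coupling_comm y.1 x.1, spinDot_comm (ω y) (ω x)]
  ring

theorem potential_congr {A : Finset S} {ω ω' : Config S} (h : ∀ x ∈ A, ω x = ω' x) :
    potential α A ω = potential α A ω' := by
  unfold potential
  split_ifs
  · congr 1
    refine Finset.sum_congr rfl fun p hp => ?_
    rw [Finset.mem_offDiag] at hp
    rw [h _ hp.1, h _ hp.2.1]
  · rfl

theorem continuous_potential (A : Finset S) : Continuous (potential α A) := by
  unfold potential
  split_ifs
  · refine continuous_const.mul (continuous_finsetSum _ fun p _ => continuous_const.mul ?_)
    exact continuous_spinDot.comp (g := fun p : Spin × Spin => spinDot p.1 p.2)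
      (f := fun ω : Config S => (ω p.1, ω p.2))
      ((continuous_apply p.1).prodMk (continuous_apply p.2))
  · exact continuous_const

/-- A bound for the potential of the set `A`. -/
noncomputable def potentialBound (α : ℝ) (A : Finset S) : ℝ :=
  if A.card = 2 then (1 / 2) * ∑ p ∈ A.offDiag, (coupling α p.1.1 p.2.1 : ℝ) else 0

theorem potentialBound_nonneg (A : Finset S) : 0 ≤ potentialBound α A := by
  unfold potentialBound
  split_ifs
  · exact mul_nonneg (by norm_num) (Finset.sum_nonneg fun _ _ => NNReal.coe_nonneg _)
  · exact le_rfl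

theorem abs_potential_le (A : Finset S) (ω : Config S) :
    |potential α A ω| ≤ potentialBound α A := by
  unfold potential potentialBound
  split_ifs
  · rw [abs_mul, abs_of_pos (by norm_num : (0 : ℝ) < 1 / 2)]
    refine mul_le_mul_of_nonneg_left ((Finset.abs_sum_le_sum_abs _ _).trans
      (Finset.sum_le_sum fun p _ => ?_)) (by norm_num)
    rw [← coe_coupling, abs_mul, abs_of_nonneg (NNReal.coe_nonneg _)]
    exact mul_le_of_le_one_right (NNReal.coe_nonneg _) (abs_spinDot_le_one _ _)
  · simp

/-- Among the sets containing x only the pairs {x, y} contribute, so the sum is one over y. At y = x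
the set is a singleton with bound zero, so y can range over all of S. -/
theorem summable_potentialBound_mem (hα : (d : ℝ) < α) (x : S) :
    Summable fun A : Finset S => if x ∈ A then potentialBound α A else 0 := by
  have hinj : Function.Injective fun y : S => ({x, y} : Finset S) := by
    intro y z h
    have h' : ({x, y} : Finset S) = {x, z} := h
    have hy : y ∈ ({x, z} : Finset S) := by
      rw [← h']
      simp
    have hz : z ∈ ({x, y} : Finset S) := by
      rw [h']
      simp
    simp only [Finset.mem_insert, Finset.mem_singleton] at hy hz
    rcases hy with rfl | rfl
    · rcases hz with rfl | rfl <;> rfl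
    · rfl
  refine (hinj.summable_iff fun A hA => ?_).1 ?_
  · split_ifs with hx
    · rw [potentialBound, if_neg]
      intro hcard
      obtain ⟨a, b, -, rfl⟩ := Finset.card_eq_two.1 hcard
      simp only [Finset.mem_insert, Finset.mem_singleton] at hx
      rcases hx with rfl | rfl
      · exact hA ⟨b, rfl⟩
      · exact hA ⟨a, Finset.pair_comm _ _⟩
    · rfl
  · refine Summable.of_nonneg_of_le (fun y => ?_) (fun y => ?_) (summable_coupling hα (S := S) x.1)
    · simp only [comp_apply, Finset.mem_insert_self, if_true]
      exact potentialBound_nonneg _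
    · simp only [comp_apply, Finset.mem_insert_self, if_true]
      by_cases h : x = y
      · subst h
        simp [potentialBound]
      · rw [potentialBound, if_pos (Finset.card_pair h), sum_offDiag_pair h,
          coupling_comm y.1 x.1]
        linarith

theorem summable_potentialBound (hα : (d : ℝ) < α) (Λ : Finset S) :
    Summable fun A : {A : Finset S // (A ∩ Λ).Nonempty} => potentialBound α A.1 := by
  have h : Summable fun A : Finset S => ∑ x ∈ Λ, if x ∈ A then potentialBound α A else 0 :=
    summable_sum fun x _ => summable_potentialBound_mem hα x
  refine Summable.of_nonneg_of_le (fun A => potentialBound_nonneg _) (fun A => ?_)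
    (h.comp_injective Subtype.val_injective)
  obtain ⟨x, hx⟩ := A.2
  rw [Finset.mem_inter] at hx
  calc potentialBound α A.1 = if x ∈ A.1 then potentialBound α A.1 else 0 := by rw [if_pos hx.1]
    _ ≤ _ := Finset.single_le_sum (f := fun x => if x ∈ A.1 then potentialBound α A.1 else 0)
      (fun y _ => by
        split_ifs
        · exact potentialBound_nonneg _
        · exact le_rfl) hx.2

theorem summable_potential (hα : (d : ℝ) < α) (Λ : Finset S) (ω : Config S) :
    Summable fun A : {A : Finset S // (A ∩ Λ).Nonempty} => potential α A.1 ω :=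
  Summable.of_norm_bounded (summable_potentialBound hα Λ) fun A => abs_potential_le A.1 ω

theorem continuous_hamiltonian (hα : (d : ℝ) < α) (Λ : Finset S) :
    Continuous (hamiltonian α Λ) :=
  continuous_tsum (fun A => continuous_potential A.1) (summable_potentialBound hα Λ)
    fun A ω => abs_potential_le A.1 ω

/-- With one index type for all volumes, energy differences in different volumes can be compared
term by term. -/
theorem hamiltonian_sub (hα : (d : ℝ) < α) (Λ : Finset S) (ω ω' : Config S) :
    hamiltonian α Λ ω - hamiltonian α Λ ω' =
      ∑' A : Finset S, if (A ∩ Λ).Nonempty then potential α A ω - potential α A ω' else 0 := by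
  rw [hamiltonian, hamiltonian, ← (summable_potential hα Λ ω).tsum_sub (summable_potential hα Λ ω')]
  refine (tsum_subtype {A : Finset S | (A ∩ Λ).Nonempty}
    fun A => potential α A ω - potential α A ω').trans (tsum_congr fun A => ?_)
  rw [Set.indicator_apply]
  rfl

/-- If ω and ω' agree off Δ, the term of a set that misses Δ is the same for both, so only the sets
that meet Δ contribute to the energy difference. -/
theorem isEnergy_hamiltonian (hα : (d : ℝ) < α) (β : ℝ) :
    IsEnergy fun (Λ : Finset S) (ω : Config S) => -(β * hamiltonian α Λ ω) where
  continuous Λ := (continuous_const.mul (continuous_hamiltonian hα Λ)).neg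
  consistent {Δ Λ} hΔ {ω ω'} hag := by
    have key : hamiltonian α Λ ω - hamiltonian α Λ ω' =
        hamiltonian α Δ ω - hamiltonian α Δ ω' := by
      rw [hamiltonian_sub hα, hamiltonian_sub hα]
      refine tsum_congr fun A => ?_
      by_cases hA : (A ∩ Δ).Nonempty
      · rw [if_pos hA, if_pos (hA.mono (Finset.inter_subset_inter_left hΔ))]
      · rw [if_neg hA, potential_congr (ω' := ω') fun x hx => hag x fun hxΔ =>
          hA ⟨x, Finset.mem_inter.2 ⟨hx, hxΔ⟩⟩]
        simp
    linear_combination (-β) * key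

/-- Only the pair {x, w} both meets `{x}` and sees the spin at w. -/
theorem hamiltonian_singleton_sub (hα : (d : ℝ) < α) {x w : S} (hwx : w ≠ x) {ω ω' : Config S}
    (hag : ∀ y, y ≠ w → ω y = ω' y) :
    hamiltonian α {x} ω - hamiltonian α {x} ω' =
      coupling α x.1 w.1 * (spinDot (ω x) (ω w) - spinDot (ω x) (ω' w)) := by
  rw [hamiltonian_sub hα, tsum_eq_single ({x, w} : Finset S)]
  · rw [if_pos ⟨x, by simp⟩, potential_pair hwx.symm, potential_pair hwx.symm, hag x hwx.symm]
    ring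
  · intro A hA
    split_ifs with h
    · have hx : x ∈ A := by
        obtain ⟨y, hy⟩ := h
        rw [Finset.mem_inter, Finset.mem_singleton] at hy
        exact hy.2 ▸ hy.1
      by_cases hw : w ∈ A
      · have hcard : A.card ≠ 2 := by
          intro hc
          refine hA (Finset.eq_of_subset_of_card_le ?_ ?_).symm
          · intro y hy
            simp only [Finset.mem_insert, Finset.mem_singleton] at hy
            rcases hy with rfl | rfl <;> assumption
          · rw [hc, Finset.card_pair hwx.symm]
        simp [potential, hcard]
      · rw [potential_congr (ω' := ω') fun y hy => hag y fun h => hw (h ▸ hy), sub_self]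
    · rfl

end Hamiltonian

/-! ### The constrained specification as a system of local Gibbs distributions -/

section ConstrainedKernel

variable {d : ℕ} {α : ℝ} {S : Set (Site d)} (q : ℕ) [NeZero q]

theorem glue_eq_updateFinset {V E : Type} [DecidableEq V] (Λ : Finset V) (ζ : Λ → E) (η : V → E) :
    glue Λ ζ η = updateFinset η Λ ζ := by
  ext x
  by_cases h : x ∈ Λ <;> simp [glue, updateFinset, h]

theorem constrainedKernel_eq_localGibbs (hα : (d : ℝ) < α) (β : ℝ) (σ : DConfig q S)
    (Λ : Finset S) (η : Config S) :
    constrainedKernel α β q σ Λ η = localGibbs (fun x => arcMeasure q (σ x))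
      (fun (Λ : Finset S) (ω : Config S) => -(β * hamiltonian α Λ ω)) Λ η := by
  have h := (isEnergy_hamiltonian (S := S) hα β).cond_eq_localGibbs (volume : Measure Spin)
    (A := fun x => {θ : Spin | coarse q θ = σ x}) (fun x => measurableSet_arc q (σ x))
    (fun x => volume_arc_ne_zero q (σ x)) Λ η
  simp only [constrainedKernel, gibbsKernel, gibbsWeight, glue_eq_updateFinset]
  exact h

theorem isConstrainedGibbs_iff (hα : (d : ℝ) < α) (β : ℝ) (σ : DConfig q S)
    (μ : Measure (Config S)) : IsConstrainedGibbs α β q σ μ ↔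
      IsLocalGibbs (fun x => arcMeasure q (σ x))
        (fun (Λ : Finset S) (ω : Config S) => -(β * hamiltonian α Λ ω)) μ := by
  have hU := isEnergy_hamiltonian (S := S) hα β
  simp only [IsConstrainedGibbs, IsLocalGibbs, constrainedKernel_eq_localGibbs q hα]
  refine and_congr_right fun _ => forall_congr' fun Λ => ?_
  rw [Measure.ext_iff]
  refine forall₂_congr fun B hB => ?_
  rw [Measure.bind_apply hB (hU.measurable_localGibbs _ Λ).aemeasurable]

/-- The energy changes for the spin values s and t are each bounded by |β| times the coupling times
K and may have opposite signs, hence the factor 2. -/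
theorem energy_osc_le (hα : (d : ℝ) < α) (β : ℝ) {x w : S} (hwx : w ≠ x) {η ζ : Config S}
    (hag : ∀ y, y ≠ w → η y = ζ y) {K : ℝ} (hK : ∀ s, |spinDot s (η w) - spinDot s (ζ w)| ≤ K)
    (s t : Spin) :
    (-(β * hamiltonian α {x} (update η x s)) - -(β * hamiltonian α {x} (update ζ x s))) -
      (-(β * hamiltonian α {x} (update η x t)) - -(β * hamiltonian α {x} (update ζ x t))) ≤
        2 * (|β| * coupling α x.1 w.1 * K) := by
  have h : ∀ s, hamiltonian α {x} (update η x s) - hamiltonian α {x} (update ζ x s) =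
      coupling α x.1 w.1 * (spinDot s (η w) - spinDot s (ζ w)) := fun s => by
    rw [hamiltonian_singleton_sub hα hwx (ω := update η x s) (ω' := update ζ x s)]
    · simp [hwx]
    · intro y hy
      by_cases hyx : y = x
      · subst hyx
        simp
      · simp [hyx, hag y hy]
  have hb : ∀ s, |β * (coupling α x.1 w.1 * (spinDot s (η w) - spinDot s (ζ w)))| ≤
      |β| * coupling α x.1 w.1 * K := fun s => by
    rw [abs_mul, abs_mul, abs_of_nonneg (NNReal.coe_nonneg _), ← mul_assoc]
    exact mul_le_mul_of_nonneg_left (hK s) (mul_nonneg (abs_nonneg _) (NNReal.coe_nonneg _))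
  have h1 := (abs_le.1 (hb s)).1
  have h2 := (abs_le.1 (hb t)).2
  rw [← h] at h1 h2
  linarith

end ConstrainedKernel

/-! ### Uniqueness of the constrained Gibbs measure and its dependence on the labels -/

section Uniqueness

variable {d : ℕ} {α β : ℝ} {q : ℕ} [NeZero q] {S : Set (Site d)}

/-- The influence of the spin at `y`, moving within its arc, on the spin at `x`. -/
noncomputable def arcInfluence (α β : ℝ) (q : ℕ) (x y : Site d) : ℝ≥0 :=
  (|β| * (Real.pi / q)).toNNReal * coupling α x y

/-- The influence of the spin at `y`, moving on the whole circle, on the spin at `x`. -/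
noncomputable def circleInfluence (α β : ℝ) (x y : Site d) : ℝ≥0 :=
  |β|.toNNReal * coupling α x y

/-- The sum of the interaction strengths of a site with all others. -/
noncomputable def totalCoupling (d : ℕ) (α : ℝ) : ℝ :=
  ∑' x : {x : Site d // x ≠ 0}, siteNorm x.1 ^ (-α)

theorem tsum_arcInfluence_le (hα : (d : ℝ) < α) (z : S) :
    ∑' w : S, (arcInfluence α β q z.1 w.1 : ℝ≥0∞) ≤
      ENNReal.ofReal (|β| * (Real.pi / q) * totalCoupling d α) := by
  simp only [arcInfluence, ENNReal.coe_mul]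
  rw [ENNReal.tsum_mul_left, ENNReal.ofReal_mul (by positivity)]
  exact mul_le_mul_right (tsum_coupling_le hα _) _

theorem tsum_circleInfluence_le (hα : (d : ℝ) < α) (z : S) :
    ∑' w : S, (circleInfluence α β z.1 w.1 : ℝ≥0∞) ≤
      ENNReal.ofReal (|β| * totalCoupling d α) := by
  simp only [circleInfluence, ENNReal.coe_mul]
  rw [ENNReal.tsum_mul_left, ENNReal.ofReal_mul (by positivity)]
  exact mul_le_mul_right (tsum_coupling_le hα _) _

theorem dobrushin_lt_one (hq : |β| * Real.pi * totalCoupling d α < q) :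
    ENNReal.ofReal (|β| * (Real.pi / q) * totalCoupling d α) < 1 := by
  have hq0 : (0 : ℝ) < q := Nat.cast_pos.mpr (NeZero.pos q)
  rw [← ENNReal.ofReal_one, ENNReal.ofReal_lt_ofReal_iff one_pos,
    show |β| * (Real.pi / q) * totalCoupling d α = |β| * Real.pi * totalCoupling d α / q by ring,
    div_lt_one hq0]
  exact hq

/-- With K = 2π/q the oscillation is 4 |β| (π/q) times the coupling; the 4 cancels against the 1/4
of the total variation bound. -/
theorem energy_osc_arc_le (hα : (d : ℝ) < α) {x w : S} (hwx : w ≠ x) {η ζ : Config S}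
    (hag : ∀ y, y ≠ w → η y = ζ y) (harc : coarse q (η w) = coarse q (ζ w)) (s t : Spin) :
    (-(β * hamiltonian α {x} (update η x s)) - -(β * hamiltonian α {x} (update ζ x s))) -
      (-(β * hamiltonian α {x} (update η x t)) - -(β * hamiltonian α {x} (update ζ x t))) ≤
        4 * arcInfluence α β q x.1 w.1 := by
  refine (energy_osc_le hα β hwx hag (abs_spinDot_sub_le q harc) s t).trans (le_of_eq ?_)
  rw [arcInfluence, NNReal.coe_mul, Real.coe_toNNReal _ (by positivity)]
  ring

theorem energy_osc_circle_le (hα : (d : ℝ) < α) {x w : S} (hwx : w ≠ x) {η ζ : Config S}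
    (hag : ∀ y, y ≠ w → η y = ζ y) (s t : Spin) :
    (-(β * hamiltonian α {x} (update η x s)) - -(β * hamiltonian α {x} (update ζ x s))) -
      (-(β * hamiltonian α {x} (update η x t)) - -(β * hamiltonian α {x} (update ζ x t))) ≤
        4 * circleInfluence α β x.1 w.1 := by
  refine (energy_osc_le hα β hwx hag (K := 2) (fun s => ?_) s t).trans (le_of_eq ?_)
  · have h1 := abs_spinDot_le_one s (η w)
    have h2 := abs_spinDot_le_one s (ζ w)
    exact (abs_sub _ _).trans (by linarith)
  · rw [circleInfluence, NNReal.coe_mul, Real.coe_toNNReal _ (abs_nonneg _)]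
    ring

theorem existsUnique_isConstrainedGibbs (hα : (d : ℝ) < α)
    (hq : |β| * Real.pi * totalCoupling d α < q) (σ : DConfig q S) :
    ∃! μ : Measure (Config S), IsConstrainedGibbs α β q σ μ := by
  simp only [isConstrainedGibbs_iff q hα]
  have hU := isEnergy_hamiltonian (S := S) hα β
  obtain ⟨μ, hμ⟩ := hU.exists_isLocalGibbs (fun x => arcMeasure q (σ x))
  refine ⟨μ, hμ, fun ν hν => ?_⟩
  refine hU.isLocalGibbs_unique hν hμ (E := fun x => {s | coarse q s = σ x})
    (fun x => measurableSet_arc q (σ x)) (fun x => ae_arcMeasure q (σ x))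
    (C := fun x y => arcInfluence α β q x.1 y.1) (dobrushin_lt_one hq) (tsum_arcInfluence_le hα) ?_
  intro x w hwx η ζ hη hζ hag s t
  exact energy_osc_arc_le hα hwx hag ((hη w).trans (hζ w).symm) s t

theorem isConstrainedGibbs_constrainedGibbs (hα : (d : ℝ) < α)
    (hq : |β| * Real.pi * totalCoupling d α < q) (σ : DConfig q S) :
    IsConstrainedGibbs α β q σ (constrainedGibbs α β q σ) := by
  have h := (existsUnique_isConstrainedGibbs hα hq σ).exists
  rw [constrainedGibbs, dif_pos h]
  exact h.choose_spec

/-- The total influence of a change of the label at `y` on an observable with oscillations `δ`. -/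
noncomputable def labelInfluence (α β : ℝ) (q : ℕ) (δ : S → ℝ≥0) (y : S) : ℝ≥0∞ :=
  δ y + ∑' z : S, green (fun z w : S => (arcInfluence α β q z.1 w.1 : ℝ≥0∞))
    (fun z w : S => (circleInfluence α β z.1 w.1 : ℝ≥0∞)) z y * δ z

theorem tsum_labelInfluence_ne_top (hα : (d : ℝ) < α)
    (hq : |β| * Real.pi * totalCoupling d α < q) {δ : S → ℝ≥0}
    (hsum : ∑' z, (δ z : ℝ≥0∞) ≠ ∞) : ∑' y, labelInfluence α β q δ y ≠ ∞ := by
  simp only [labelInfluence]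
  rw [ENNReal.tsum_add, ENNReal.tsum_comm]
  refine ENNReal.add_ne_top.2 ⟨hsum, ?_⟩
  refine ne_top_of_le_ne_top (b := ∑' z, (1 - ENNReal.ofReal (|β| * (Real.pi / q) *
    totalCoupling d α))⁻¹ * ENNReal.ofReal (|β| * totalCoupling d α) * (δ z : ℝ≥0∞)) ?_
    (ENNReal.tsum_le_tsum fun z => ?_)
  · rw [ENNReal.tsum_mul_left]
    exact ENNReal.mul_ne_top (ENNReal.mul_ne_top
      (ENNReal.inv_ne_top.2 (tsub_pos_of_lt (dobrushin_lt_one hq)).ne') ENNReal.ofReal_ne_top) hsum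
  · rw [ENNReal.tsum_mul_right]
    exact mul_le_mul_left (tsum_green_le (tsum_arcInfluence_le hα) (tsum_circleInfluence_le hα) z) _

/-- The comparison theorem with D the set of differing labels. The weights on the right do not
depend on σ and τ and are summable, which serves both continuity and summable oscillations. -/
theorem abs_integral_constrainedGibbs_sub_le (hα : (d : ℝ) < α)
    (hq : |β| * Real.pi * totalCoupling d α < q) (σ τ : DConfig q S) {f : Config S → ℝ}
    (hf : Continuous f) {δ : S → ℝ≥0} (hδ : OscBound (fun _ => Set.univ) f δ)
    (hsum : ∑' z, (δ z : ℝ≥0∞) ≠ ∞) :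
    ENNReal.ofReal |(∫ ω, f ω ∂(constrainedGibbs α β q σ)) -
      ∫ ω, f ω ∂(constrainedGibbs α β q τ)| ≤
        ∑' y : {y | σ y ≠ τ y}, labelInfluence α β q δ y.1 := by
  have hU := isEnergy_hamiltonian (S := S) hα β
  have hμ := (isConstrainedGibbs_iff q hα β σ _).1 (isConstrainedGibbs_constrainedGibbs hα hq σ)
  have hν := (isConstrainedGibbs_iff q hα β τ _).1 (isConstrainedGibbs_constrainedGibbs hα hq τ)
  refine hU.abs_integral_sub_le hμ hν
    -- Where the labels differ, the two measures live on different arcs and both must be allowed, so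
    -- only the circle influence is available there. Elsewhere the union is a single arc.
    (E := fun x => {s | coarse q s = σ x} ∪ {s | coarse q s = τ x})
    (fun x => (measurableSet_arc q (σ x)).union (measurableSet_arc q (τ x)))
    (fun x => (ae_arcMeasure q (σ x)).mono fun s hs => Or.inl hs)
    (fun x => (ae_arcMeasure q (τ x)).mono fun s hs => Or.inr hs)
    (D := {y | σ y ≠ τ y}) (fun x hx => by
      have : σ x = τ x := by simpa using hx
      simp only [this])
    (C := fun x y => arcInfluence α β q x.1 y.1) (B := fun x y => circleInfluence α β x.1 y.1)
    (dobrushin_lt_one hq) ENNReal.ofReal_ne_top (tsum_arcInfluence_le hα)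
    (tsum_circleInfluence_le hα) ?_ hf
    (fun z η ζ _ _ hag => hδ z η ζ (fun _ => trivial) (fun _ => trivial) hag) hsum
  intro x hx w hwx η ζ hη hζ hag s t
  by_cases hw : w ∈ {y | σ y ≠ τ y}
  · simp only [hw, if_true]
    exact energy_osc_circle_le hα hwx hag s t
  · simp only [hw, if_false]
    have hst : σ w = τ w := by simpa using hw
    have harc : ∀ ξ : Config S, ξ w ∈ {s | coarse q s = σ w} ∪ {s | coarse q s = τ w} →
        coarse q (ξ w) = σ w := by
      rintro ξ (h | h)
      · exact h
      · exact h.trans hst.symm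
    exact energy_osc_arc_le hα hwx hag ((harc η (hη w)).trans (harc ζ (hζ w)).symm) s t

end Uniqueness

/-! ### Bounds and oscillations of the rotation rate -/

section SiteWeight

variable {d : ℕ} {α β : ℝ} {q : ℕ} [NeZero q]

theorem continuous_insertSpin (x : Site d) :
    Continuous fun p : Spin × Config ({x}ᶜ : Set (Site d)) => insertSpin x p.1 p.2 := by
  refine continuous_pi fun y => ?_
  by_cases h : y.1 = x
  · simp only [insertSpin, h, dite_true]
    exact continuous_fst
  · simp only [insertSpin, h, dite_false]
    exact (continuous_apply _).comp continuous_snd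

theorem continuous_siteEnergy (hα : (d : ℝ) < α) (x : Site d) :
    Continuous fun p : Spin × Config ({x}ᶜ : Set (Site d)) => siteEnergy α x p.1 p.2 :=
  (continuous_hamiltonian hα _).comp (continuous_insertSpin x)

theorem abs_siteEnergy_sub_le (hα : (d : ℝ) < α) (x : Site d) (θ : Spin)
    {z : ({x}ᶜ : Set (Site d))} {η ζ : Config ({x}ᶜ : Set (Site d))}
    (hag : ∀ y, y ≠ z → η y = ζ y) :
    |siteEnergy α x θ η - siteEnergy α x θ ζ| ≤ 2 * coupling α x z.1 := by
  have hzx : z.1 ≠ x := z.2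
  rw [siteEnergy, siteEnergy, hamiltonian_singleton_sub hα (x := ⟨x, Set.mem_univ x⟩)
    (w := ⟨z.1, Set.mem_univ z.1⟩) (fun h => hzx (congrArg Subtype.val h))]
  · rw [abs_mul, abs_of_nonneg (NNReal.coe_nonneg _), mul_comm 2]
    refine mul_le_mul_of_nonneg_left ?_ (NNReal.coe_nonneg _)
    refine (abs_sub _ _).trans ?_
    linarith [abs_spinDot_le_one (insertSpin x θ η ⟨x, Set.mem_univ x⟩)
      (insertSpin x θ η ⟨z.1, Set.mem_univ z.1⟩),
      abs_spinDot_le_one (insertSpin x θ η ⟨x, Set.mem_univ x⟩)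
      (insertSpin x θ ζ ⟨z.1, Set.mem_univ z.1⟩)]
  · intro y hy
    by_cases h : y.1 = x
    · simp [insertSpin, h]
    · simp only [insertSpin, h, dite_false]
      refine hag _ fun h' => hy (Subtype.ext ?_)
      exact congrArg (fun y : ({x}ᶜ : Set (Site d)) => y.1) h'

theorem exp_sub_exp_le {a b K : ℝ} (ha : a ≤ K) : Real.exp a - Real.exp b ≤ Real.exp K * |a - b| := by
  have h := Real.add_one_le_exp (b - a)
  calc Real.exp a - Real.exp b = Real.exp a * (1 - Real.exp (b - a)) := by
        rw [mul_sub, ← Real.exp_add]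
        ring_nf
    _ ≤ Real.exp a * |a - b| :=
        mul_le_mul_of_nonneg_left (by linarith [le_abs_self (a - b)]) (Real.exp_pos _).le
    _ ≤ Real.exp K * |a - b| :=
        mul_le_mul_of_nonneg_right (Real.exp_le_exp.2 ha) (abs_nonneg _)

/-- The Boltzmann weight of the spin at `x`, integrated over `ρ`, given the other spins. -/
noncomputable def siteWeight (α β : ℝ) (x : Site d) (ρ : Measure Spin)
    (ω : Config ({x}ᶜ : Set (Site d))) : ℝ :=
  ∫ θ, Real.exp (-(β * siteEnergy α x θ ω)) ∂ρ

theorem continuous_exp_siteEnergy (hα : (d : ℝ) < α) (β : ℝ) (x : Site d) :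
    Continuous fun p : Spin × Config ({x}ᶜ : Set (Site d)) =>
      Real.exp (-(β * siteEnergy α x p.1 p.2)) :=
  ((continuous_siteEnergy hα x).const_mul β).neg.rexp

theorem continuous_siteWeight (hα : (d : ℝ) < α) (β : ℝ) (x : Site d) (ρ : Measure Spin)
    [IsFiniteMeasure ρ] : Continuous (siteWeight α β x ρ) := by
  have h : Continuous fun p : Config ({x}ᶜ : Set (Site d)) × Spin =>
      Real.exp (-(β * siteEnergy α x p.2 p.1)) :=
    (continuous_exp_siteEnergy hα β x).comp
      (g := fun p : Spin × Config ({x}ᶜ : Set (Site d)) => Real.exp (-(β * siteEnergy α x p.1 p.2)))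
      (f := Prod.swap) continuous_swap
  exact continuous_integral_of_compactSpace ρ
    (G := fun ω θ => Real.exp (-(β * siteEnergy α x θ ω))) h

theorem integrable_exp_siteEnergy (hα : (d : ℝ) < α) (β : ℝ) (x : Site d) (ρ : Measure Spin)
    [IsFiniteMeasure ρ] (ω : Config ({x}ᶜ : Set (Site d))) :
    Integrable (fun θ => Real.exp (-(β * siteEnergy α x θ ω))) ρ := by
  refine integrable_of_continuous_of_compactSpace ρ ?_
  exact (continuous_exp_siteEnergy hα β x).comp
    (g := fun p : Spin × Config ({x}ᶜ : Set (Site d)) => Real.exp (-(β * siteEnergy α x p.1 p.2)))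
    (f := fun θ => (θ, ω)) (Continuous.prodMk_left ω)

/-- K bounds the exponent by compactness and does not depend on ρ. The spin at z enters the energy
at x only through the coupling of x and z, and the exponential is Lipschitz with constant exp K
where the exponent is at most K. -/
theorem exists_siteWeight_bounds (hα : (d : ℝ) < α) (β : ℝ) (x : Site d) :
    ∃ K : ℝ, ∀ (ρ : Measure Spin) [IsFiniteMeasure ρ],
      (∀ ω, Real.exp (-K) * ρ.real Set.univ ≤ siteWeight α β x ρ ω) ∧
      (∀ ω, siteWeight α β x ρ ω ≤ Real.exp K * ρ.real Set.univ) ∧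
      OscBound (fun _ => Set.univ) (siteWeight α β x ρ)
        fun z => (Real.exp K * (2 * |β|) * ρ.real Set.univ).toNNReal * coupling α x z.1 := by
  obtain ⟨K, hK'⟩ := exists_abs_le_of_continuous ((continuous_siteEnergy hα x).const_mul β).neg
  have hK : ∀ p : Spin × Config ({x}ᶜ : Set (Site d)), |-(β * siteEnergy α x p.1 p.2)| ≤ K := hK'
  refine ⟨K, fun ρ _ => ⟨fun ω => ?_, fun ω => ?_, ?_⟩⟩
  · have := integral_mono (integrable_const (Real.exp (-K))) (integrable_exp_siteEnergy hα β x ρ ω)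
      fun θ => Real.exp_le_exp.2 (abs_le.1 (hK (θ, ω))).1
    rw [siteWeight]
    simpa [mul_comm] using this
  · have := integral_mono (integrable_exp_siteEnergy hα β x ρ ω) (integrable_const (Real.exp K))
      fun θ => Real.exp_le_exp.2 (abs_le.1 (hK (θ, ω))).2
    rw [siteWeight]
    simpa [mul_comm] using this
  · intro z η ζ _ _ hag
    rw [siteWeight, siteWeight, ← integral_sub (integrable_exp_siteEnergy hα β x ρ η)
      (integrable_exp_siteEnergy hα β x ρ ζ)]
    have hb : ∀ θ, |-(β * siteEnergy α x θ η) - -(β * siteEnergy α x θ ζ)| ≤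
        2 * |β| * coupling α x z.1 := fun θ => by
      rw [show -(β * siteEnergy α x θ η) - -(β * siteEnergy α x θ ζ) =
        -(β * (siteEnergy α x θ η - siteEnergy α x θ ζ)) by ring, abs_neg, abs_mul]
      nlinarith [abs_siteEnergy_sub_le hα x θ hag, abs_nonneg β]
    have hpt : ∀ θ, ‖Real.exp (-(β * siteEnergy α x θ η)) - Real.exp (-(β * siteEnergy α x θ ζ))‖ ≤
        Real.exp K * (2 * |β| * coupling α x z.1) := fun θ => by
      have h1 := exp_sub_exp_le (b := -(β * siteEnergy α x θ ζ)) (abs_le.1 (hK (θ, η))).2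
      have h2 := exp_sub_exp_le (b := -(β * siteEnergy α x θ η)) (abs_le.1 (hK (θ, ζ))).2
      rw [abs_sub_comm] at h2
      have h3 := mul_le_mul_of_nonneg_left (hb θ) (Real.exp_pos K).le
      rw [Real.norm_eq_abs]
      exact abs_le.2 ⟨by linarith, by linarith⟩
    refine (norm_integral_le_of_norm_le_const (ae_of_all _ hpt)).trans (le_of_eq ?_)
    rw [NNReal.coe_mul, Real.coe_toNNReal _ (by positivity)]
    ring

/-- The numerator and the denominator of the rates, for `ρ` a point mass or the uniform
distribution on an arc. -/
noncomputable def meanWeight (α β : ℝ) (q : ℕ) [NeZero q] (x : Site d) (ρ : Measure Spin)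
    (η : Site d → Fin q) : ℝ :=
  ∫ ω, siteWeight α β x ρ ω ∂(constrainedGibbs α β q (restr {x}ᶜ η))

theorem rotationRate_eq (x : Site d) (η : Site d → Fin q) :
    rotationRate α β q x η =
      meanWeight α β q x (Measure.dirac ((arcRight q (η x) : ℝ) : Spin)) η /
        meanWeight α β q x (arcMeasure q (η x)) η := by
  simp only [rotationRate, meanWeight, siteWeight, integral_dirac, arcMeasure]

theorem tsum_const_mul_coupling_ne_top (hα : (d : ℝ) < α) (c : ℝ≥0) (x : Site d)
    (S : Set (Site d)) : ∑' z : S, ((c * coupling α x z.1 : ℝ≥0) : ℝ≥0∞) ≠ ∞ := by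
  simp only [ENNReal.coe_mul]
  rw [ENNReal.tsum_mul_left]
  exact ENNReal.mul_ne_top ENNReal.coe_ne_top
    (ne_top_of_le_ne_top ENNReal.ofReal_ne_top (tsum_coupling_le hα x))

/-- Pointwise bounds on `siteWeight` survive averaging, and its oscillations, proportional to the
couplings with x, are summable, so its mean depends summably on the labels. -/
theorem exists_meanWeight_bounds (hα : (d : ℝ) < α)
    (hq : |β| * Real.pi * totalCoupling d α < q) (x : Site d) :
    ∃ K : ℝ, ∃ g : Measure Spin → ({x}ᶜ : Set (Site d)) → ℝ≥0∞,
      ∀ (ρ : Measure Spin) [IsFiniteMeasure ρ], ∑' y, g ρ y ≠ ∞ ∧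
        (∀ η, Real.exp (-K) * ρ.real Set.univ ≤ meanWeight α β q x ρ η) ∧
        (∀ η, meanWeight α β q x ρ η ≤ Real.exp K * ρ.real Set.univ) ∧
        ∀ η ζ, ENNReal.ofReal |meanWeight α β q x ρ η - meanWeight α β q x ρ ζ| ≤
          ∑' y : {y : ({x}ᶜ : Set (Site d)) | η y.1 ≠ ζ y.1}, g ρ y.1 := by
  obtain ⟨K, hK⟩ := exists_siteWeight_bounds hα β x
  refine ⟨K, fun ρ => labelInfluence α β q fun z =>
    (Real.exp K * (2 * |β|) * ρ.real Set.univ).toNNReal * coupling α x z.1, fun ρ _ => ?_⟩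
  obtain ⟨hlow, hup, hosc⟩ := hK ρ
  have hsum := tsum_const_mul_coupling_ne_top hα
    (Real.exp K * (2 * |β|) * ρ.real Set.univ).toNNReal x ({x}ᶜ : Set (Site d))
  have hcont := continuous_siteWeight hα β x ρ
  refine ⟨tsum_labelInfluence_ne_top hα hq hsum, fun η => ?_, fun η => ?_, fun η ζ =>
    abs_integral_constrainedGibbs_sub_le hα hq _ _ hcont hosc hsum⟩
  · have := (isConstrainedGibbs_constrainedGibbs hα hq (restr {x}ᶜ η)).1
    have h := integral_mono (μ := constrainedGibbs α β q (restr {x}ᶜ η)) (integrable_const _)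
      (integrable_of_continuous_of_compactSpace _ hcont) hlow
    rw [meanWeight]
    simpa using h
  · have := (isConstrainedGibbs_constrainedGibbs hα hq (restr {x}ᶜ η)).1
    have h := integral_mono (μ := constrainedGibbs α β q (restr {x}ᶜ η))
      (integrable_of_continuous_of_compactSpace _ hcont) (integrable_const _) hup
    rw [meanWeight]
    simpa using h

theorem abs_div_sub_div_le {a b a' b' l u : ℝ} (hl : 0 < l) (hb : l ≤ b) (hb' : l ≤ b')
    (ha' : |a'| ≤ u) :
    |a / b - a' / b'| ≤ l⁻¹ * |a - a'| + u * (l⁻¹ * l⁻¹) * |b - b'| := by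
  have hb0 : 0 < b := hl.trans_le hb
  have hb0' : 0 < b' := hl.trans_le hb'
  have hu : 0 ≤ u := (abs_nonneg _).trans ha'
  have h1 : b⁻¹ ≤ l⁻¹ := inv_anti₀ hl hb
  have h2 : b'⁻¹ ≤ l⁻¹ := inv_anti₀ hl hb'
  rw [show a / b - a' / b' = b⁻¹ * (a - a') + a' * (b⁻¹ * b'⁻¹) * (b' - b) by
    field_simp
    ring]
  refine (abs_add_le _ _).trans (add_le_add ?_ ?_)
  · rw [abs_mul, abs_of_pos (inv_pos.2 hb0)]
    exact mul_le_mul_of_nonneg_right h1 (abs_nonneg _)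
  · rw [abs_mul, abs_mul, abs_of_pos (mul_pos (inv_pos.2 hb0) (inv_pos.2 hb0')), abs_sub_comm b']
    gcongr

theorem arcMeasure_real_univ_pos (k : Fin q) : 0 < (arcMeasure q k).real Set.univ := by
  rw [measureReal_def]
  exact ENNReal.toReal_pos (NeZero.ne _ ∘ Measure.measure_univ_eq_zero.1) (measure_ne_top _ _)

/-- The rotation rate is positive and bounded, and its oscillations at the other sites are
summable. -/
theorem exists_rotationRate_bounds (hα : (d : ℝ) < α)
    (hq : |β| * Real.pi * totalCoupling d α < q) (x : Site d) :
    ∃ M : ℝ, ∃ g : ({x}ᶜ : Set (Site d)) → ℝ≥0∞, ∑' y, g y ≠ ∞ ∧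
      (∀ η, 0 < rotationRate α β q x η ∧ rotationRate α β q x η ≤ M) ∧
      ∀ η ζ, η x = ζ x →
        ENNReal.ofReal |rotationRate α β q x η - rotationRate α β q x ζ| ≤
          ∑' y : {y : ({x}ᶜ : Set (Site d)) | η y.1 ≠ ζ y.1}, g y.1 := by
  obtain ⟨K, g, hg⟩ := exists_meanWeight_bounds hα hq x
  let δ : Fin q → Measure Spin := fun k => Measure.dirac ((arcRight q k : ℝ) : Spin)
  let l : Fin q → ℝ := fun k => Real.exp (-K) * (arcMeasure q k).real Set.univ
  have hl : ∀ k, 0 < l k := fun k => mul_pos (Real.exp_pos _) (arcMeasure_real_univ_pos k)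
  have hnum : ∀ k η, 0 < meanWeight α β q x (δ k) η ∧ meanWeight α β q x (δ k) η ≤ Real.exp K := by
    intro k η
    have h := hg (δ k)
    have h1 := h.2.1 η
    have h2 := h.2.2.1 η
    simp only [δ, probReal_univ, mul_one] at h1 h2
    exact ⟨(Real.exp_pos _).trans_le h1, h2⟩
  have hden : ∀ k η, l k ≤ meanWeight α β q x (arcMeasure q k) η := fun k η =>
    (hg (arcMeasure q k)).2.1 η
  -- Summing over all labels k gives bounds that do not depend on the label at x.
  refine ⟨∑ k, Real.exp K * (l k)⁻¹, fun y => ∑ k, (ENNReal.ofReal (l k)⁻¹ * g (δ k) y +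
    ENNReal.ofReal (Real.exp K * ((l k)⁻¹ * (l k)⁻¹)) * g (arcMeasure q k) y), ?_, fun η => ?_,
    fun η ζ hx => ?_⟩
  · rw [Summable.tsum_finsetSum fun _ _ => ENNReal.summable]
    refine ENNReal.sum_ne_top.2 fun k _ => ?_
    rw [ENNReal.tsum_add, ENNReal.tsum_mul_left, ENNReal.tsum_mul_left]
    exact ENNReal.add_ne_top.2 ⟨ENNReal.mul_ne_top ENNReal.ofReal_ne_top (hg (δ k)).1,
      ENNReal.mul_ne_top ENNReal.ofReal_ne_top (hg (arcMeasure q k)).1⟩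
  · rw [rotationRate_eq]
    have h1 := hnum (η x) η
    have h2 := hden (η x) η
    refine ⟨div_pos h1.1 ((hl _).trans_le h2), ?_⟩
    calc _ ≤ Real.exp K * (l (η x))⁻¹ := by
          rw [div_eq_mul_inv]
          exact mul_le_mul h1.2 (inv_anti₀ (hl _) h2)
            (inv_nonneg.2 ((hl _).le.trans h2)) (Real.exp_pos _).le
      _ ≤ _ := Finset.single_le_sum (f := fun k => Real.exp K * (l k)⁻¹)
          (fun k _ => mul_nonneg (Real.exp_pos _).le (inv_nonneg.2 (hl k).le)) (Finset.mem_univ _)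
  -- Equal labels at x mean that both quotients use the same point mass and the same arc, so only
  -- the Gibbs measures differ.
  · rw [rotationRate_eq, rotationRate_eq, ← hx]
    set k := η x
    have hz := hnum k ζ
    have hle := abs_div_sub_div_le (a := meanWeight α β q x (δ k) η) (hl k) (hden k η) (hden k ζ)
      (a' := meanWeight α β q x (δ k) ζ) (u := Real.exp K) (by rw [abs_of_pos hz.1]; exact hz.2)
    refine (ENNReal.ofReal_le_ofReal hle).trans ?_
    have hli : 0 ≤ (l k)⁻¹ := inv_nonneg.2 (hl k).le
    have hli2 : 0 ≤ Real.exp K * ((l k)⁻¹ * (l k)⁻¹) :=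
      mul_nonneg (Real.exp_pos _).le (mul_nonneg hli hli)
    rw [ENNReal.ofReal_add (mul_nonneg hli (abs_nonneg _)) (mul_nonneg hli2 (abs_nonneg _)),
      ENNReal.ofReal_mul hli, ENNReal.ofReal_mul hli2]
    calc _ ≤ ∑' y : {y : ({x}ᶜ : Set (Site d)) | η y.1 ≠ ζ y.1},
          (ENNReal.ofReal (l k)⁻¹ * g (δ k) y.1 +
            ENNReal.ofReal (Real.exp K * ((l k)⁻¹ * (l k)⁻¹)) * g (arcMeasure q k) y.1) := by
          rw [ENNReal.tsum_add, ENNReal.tsum_mul_left, ENNReal.tsum_mul_left]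
          exact add_le_add (mul_le_mul_right ((hg (δ k)).2.2.2 η ζ) _)
            (mul_le_mul_right ((hg (arcMeasure q k)).2.2.2 η ζ) _)
      _ ≤ _ := ENNReal.tsum_le_tsum fun y => Finset.single_le_sum
          (f := fun k => ENNReal.ofReal (l k)⁻¹ * g (δ k) y.1 +
            ENNReal.ofReal (Real.exp K * ((l k)⁻¹ * (l k)⁻¹)) * g (arcMeasure q k) y.1)
          (fun _ _ => zero_le) (Finset.mem_univ k)

end SiteWeight

/-! ### Gibbs measures under relabelling of the sites -/

section Relabel

variable {V V' X : Type*} [DecidableEq V] [DecidableEq V'] [Countable V] [Countable V']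
  [TopologicalSpace X] [CompactSpace X] [T2Space X] [SecondCountableTopology X]
  [MeasurableSpace X] [BorelSpace X] {U : Finset V → (V → X) → ℝ} {U' : Finset V' → (V' → X) → ℝ}

theorem measurable_comp_equiv (e : V ≃ V') : Measurable fun ω : V' → X => ω ∘ e :=
  measurable_pi_iff.2 fun x => measurable_pi_apply (e x)

theorem IsEnergy.localGibbs_comp_equiv (hU : IsEnergy U) (hU' : IsEnergy U') (e : V ≃ V')
    (m : V' → Measure X) [∀ x, IsFiniteMeasure (m x)] [∀ x, NeZero (m x)]
    (hUU' : ∀ Λ ω, U' (Λ.image e) ω = U Λ (ω ∘ e)) (Λ : Finset V) (ω : V' → X) {B : Set (V → X)}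
    (hB : MeasurableSet B) : localGibbs (fun x => m (e x)) U Λ (ω ∘ e) B =
      localGibbs m U' (Λ.image e) ω ((fun ω => ω ∘ e) ⁻¹' B) := by
  have h : ∀ f : (V → X) → ℝ≥0∞, Measurable f →
      lmarginal m (Λ.image e) (fun ω => f (ω ∘ e)) ω = lmarginal (fun x => m (e x)) Λ f (ω ∘ e) :=
    fun f hf => lmarginal_image (X := fun _ : V' => X) (μ := m) e.injective Λ hf ω
  rw [hU.localGibbs_apply _ Λ _ hB,
    hU'.localGibbs_apply _ _ _ (measurable_comp_equiv e hB), ← h _ (hU.measurable_density Λ),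
    ← h (fun ω => ENNReal.ofReal (Real.exp (U Λ ω)) * B.indicator 1 ω)
      ((hU.measurable_density Λ).mul (measurable_one.indicator hB))]
  simp only [hUU']
  rfl

theorem IsLocalGibbs.map_comp_equiv (hU : IsEnergy U) (hU' : IsEnergy U') (e : V ≃ V')
    (m : V' → Measure X) [∀ x, IsFiniteMeasure (m x)] [∀ x, NeZero (m x)]
    (hUU' : ∀ Λ ω, U' (Λ.image e) ω = U Λ (ω ∘ e)) {μ : Measure (V' → X)}
    (hμ : IsLocalGibbs m U' μ) :
    IsLocalGibbs (fun x => m (e x)) U (μ.map fun ω => ω ∘ e) := by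
  have := hμ.1
  refine ⟨Measure.isProbabilityMeasure_map (measurable_comp_equiv e).aemeasurable, fun Λ => ?_⟩
  ext B hB
  have hK : Measurable fun ω => localGibbs (fun x => m (e x)) U Λ ω B :=
    (Measure.measurable_coe hB).comp (hU.measurable_localGibbs _ Λ)
  rw [Measure.bind_apply hB (hU.measurable_localGibbs _ Λ).aemeasurable,
    lintegral_map hK (measurable_comp_equiv e), Measure.map_apply (measurable_comp_equiv e) hB]
  conv_rhs => rw [← hμ.2 (Λ.image e)]
  rw [Measure.bind_apply (measurable_comp_equiv e hB)
    (hU'.measurable_localGibbs _ _).aemeasurable]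
  exact lintegral_congr fun ω => hU.localGibbs_comp_equiv hU' e m hUU' Λ ω hB

end Relabel

/-! ### Translation covariance -/

section Translation

variable {d : ℕ} {α β : ℝ} {q : ℕ} [NeZero q] {S S' : Set (Site d)}

theorem potential_image (e : S ≃ S') (he : ∀ a b : S, (e a).1 - (e b).1 = a.1 - b.1)
    (A : Finset S) (ω : Config S') : potential α (A.image e) ω = potential α A (ω ∘ e) := by
  unfold potential
  rw [Finset.card_image_of_injective _ e.injective]
  congr 2
  refine (Finset.sum_bij (fun p _ => (e p.1, e p.2)) (fun p hp => ?_) (fun p _ r _ h => ?_)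
    (fun p hp => ?_) fun p _ => ?_).symm
  · rw [Finset.mem_offDiag] at hp ⊢
    exact ⟨Finset.mem_image_of_mem _ hp.1, Finset.mem_image_of_mem _ hp.2.1,
      e.injective.ne hp.2.2⟩
  · rw [Prod.mk.injEq] at h
    exact Prod.ext (e.injective h.1) (e.injective h.2)
  · rw [Finset.mem_offDiag, Finset.mem_image, Finset.mem_image] at hp
    obtain ⟨⟨a, ha, ha'⟩, ⟨b, hb, hb'⟩, hab⟩ := hp
    refine ⟨(a, b), Finset.mem_offDiag.2 ⟨ha, hb, ?_⟩, Prod.ext ha' hb'⟩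
    rintro h
    exact hab (by rw [← ha', ← hb', show a = b from h])
  · simp only [he, comp_apply]

theorem hamiltonian_image (e : S ≃ S') (he : ∀ a b : S, (e a).1 - (e b).1 = a.1 - b.1)
    (Λ : Finset S) (ω : Config S') :
    hamiltonian α (Λ.image e) ω = hamiltonian α Λ (ω ∘ e) := by
  let E : {A : Finset S // (A ∩ Λ).Nonempty} ≃ {A : Finset S' // (A ∩ Λ.image e).Nonempty} :=
    e.finsetCongr.subtypeEquiv fun A => by
      rw [Equiv.finsetCongr_apply, Finset.map_eq_image, Equiv.coe_toEmbedding,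
        ← Finset.image_inter _ _ e.injective, Finset.image_nonempty]
  rw [hamiltonian, hamiltonian, ← E.tsum_eq]
  refine tsum_congr fun A => ?_
  rw [← potential_image e he]
  congr 1
  simp only [E, Equiv.subtypeEquiv_apply, Equiv.finsetCongr_apply, Finset.map_eq_image,
    Equiv.coe_toEmbedding]

/-- The relabelled measure satisfies the DLR equations for the relabelled constraint, because the
potential sees only differences of sites; uniqueness identifies it. -/
theorem map_constrainedGibbs (hα : (d : ℝ) < α) (hq : |β| * Real.pi * totalCoupling d α < q)
    (e : S ≃ S') (he : ∀ a b : S, (e a).1 - (e b).1 = a.1 - b.1) (σ : DConfig q S') :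
    (constrainedGibbs α β q σ).map (fun ω => ω ∘ e) =
      constrainedGibbs α β q (fun y => σ (e y)) := by
  refine (existsUnique_isConstrainedGibbs hα hq fun y => σ (e y)).unique ?_
    (isConstrainedGibbs_constrainedGibbs hα hq _)
  rw [isConstrainedGibbs_iff q hα]
  refine IsLocalGibbs.map_comp_equiv (isEnergy_hamiltonian hα β) (isEnergy_hamiltonian hα β) e
    (fun x => arcMeasure q (σ x)) (fun Λ ω => ?_)
    ((isConstrainedGibbs_iff q hα β σ _).1 (isConstrainedGibbs_constrainedGibbs hα hq σ))
  simp only [hamiltonian_image e he]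

/-- Translation by `v` of the sites other than `x`. -/
def shiftCompl (x v : Site d) : ({x}ᶜ : Set (Site d)) ≃ ({x + v}ᶜ : Set (Site d)) :=
  (Equiv.addRight v).subtypeEquiv fun y => by simp

/-- Translation by `v` of all sites. -/
def shiftUniv (v : Site d) : (Set.univ : Set (Site d)) ≃ (Set.univ : Set (Site d)) :=
  (Equiv.addRight v).subtypeEquiv fun y => by simp

theorem siteEnergy_shift (x v : Site d) (θ : Spin) (ω : Config ({x + v}ᶜ : Set (Site d))) :
    siteEnergy α (x + v) θ ω = siteEnergy α x θ (ω ∘ shiftCompl x v) := by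
  have h := hamiltonian_image (α := α) (shiftUniv v)
    (fun a b => by simp [shiftUniv]) {⟨x, Set.mem_univ x⟩} (insertSpin (x + v) θ ω)
  have h1 : insertSpin (x + v) θ ω ∘ shiftUniv v = insertSpin x θ (ω ∘ shiftCompl x v) := by
    ext y
    by_cases hy : y.1 = x
    · simp [insertSpin, shiftUniv, hy]
    · simp [insertSpin, shiftUniv, shiftCompl, hy]
  rw [h1, Finset.image_singleton] at h
  exact h

theorem meanWeight_shift (hα : (d : ℝ) < α) (hq : |β| * Real.pi * totalCoupling d α < q)
    (x v : Site d) (ρ : Measure Spin) [IsFiniteMeasure ρ] (η : Site d → Fin q) :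
    meanWeight α β q (x + v) ρ (fun y => η (y - v)) = meanWeight α β q x ρ η := by
  have hσ : restr ({x}ᶜ : Set (Site d)) η =
      fun y => restr ({x + v}ᶜ : Set (Site d)) (fun y => η (y - v)) (shiftCompl x v y) := by
    ext y
    simp [restr, shiftCompl]
  rw [meanWeight, meanWeight, hσ, ← map_constrainedGibbs hα hq (shiftCompl x v)
    (fun a b => by simp [shiftCompl]),
    integral_map (measurable_comp_equiv _).aemeasurable
      (continuous_siteWeight hα β x ρ).measurable.aestronglyMeasurable]
  simp only [siteWeight, siteEnergy_shift]

theorem rotationRate_shift (hα : (d : ℝ) < α) (hq : |β| * Real.pi * totalCoupling d α < q)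
    (x v : Site d) (η : Site d → Fin q) :
    rotationRate α β q (x + v) (fun y => η (y - v)) = rotationRate α β q x η := by
  rw [rotationRate_eq, rotationRate_eq, meanWeight_shift hα hq, meanWeight_shift hα hq,
    add_sub_cancel_right]

end Translation

/-! ### The properties of the rates -/

section Conclusions

variable {d : ℕ} {α β : ℝ} {q : ℕ} [NeZero q]

/-- Configurations that agree at x and on a finite set F have rates that differ by at most the sum
of g outside F, a tail that F makes as small as desired. -/
theorem continuous_rotationRate (hα : (d : ℝ) < α) (hq : |β| * Real.pi * totalCoupling d α < q)
    (x : Site d) : Continuous (rotationRate α β q x) := by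
  obtain ⟨M, g, hg, -, hosc⟩ := exists_rotationRate_bounds hα hq x
  refine continuous_iff_continuousAt.2 fun η => Metric.tendsto_nhds.2 fun ε hε => ?_
  have htail := (ENNReal.tendsto_tsum_compl_atTop_zero hg).eventually
    (gt_mem_nhds (ENNReal.ofReal_pos.2 hε))
  obtain ⟨F, hF⟩ := htail.exists
  have hx : ∀ᶠ ζ : Site d → Fin q in 𝓝 η, ζ x = η x :=
    (continuous_apply x).continuousAt.eventually
      (isOpen_discrete {η x} |>.eventually_mem rfl)
  have hall : ∀ᶠ ζ : Site d → Fin q in 𝓝 η, ∀ y ∈ F, ζ y.1 = η y.1 :=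
    (Finset.eventually_all F).2 fun y _ => (continuous_apply y.1).continuousAt.eventually
      (isOpen_discrete {η y.1} |>.eventually_mem rfl)
  filter_upwards [hx, hall] with ζ h1 h2
  have h3 := hosc ζ η h1
  have h4 : ∑' y : {y : ({x}ᶜ : Set (Site d)) | ζ y.1 ≠ η y.1}, g y.1 ≤ ∑' y : {y // y ∉ F}, g y.1 :=
    ENNReal.tsum_mono_subtype (s := {y : ({x}ᶜ : Set (Site d)) | ζ y.1 ≠ η y.1}) (t := {y | y ∉ F})
      g fun y hy hyF => hy (h2 y hyF)
  have h5 := (h3.trans h4).trans_lt hF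
  rw [Real.dist_eq]
  exact (ENNReal.ofReal_lt_ofReal_iff hε).1 h5

theorem rotationRates_singleton (x : Site d) (η : Site d → Fin q)
    (ξ : ({x} : Finset (Site d)) → Fin q) :
    rotationRates α β q {x} η ξ =
      if ξ ⟨x, Finset.mem_singleton_self x⟩ = η x + 1 then rotationRate α β q x η else 0 := by
  have h : glue {x} ξ η = rotate x η ↔ ξ ⟨x, Finset.mem_singleton_self x⟩ = η x + 1 := by
    constructor
    · intro h
      have := congrFun h x
      simpa [glue, rotate] using this
    · intro h
      ext y
      by_cases hy : y = x
      · subst hy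
        simp [glue, rotate, h]
      · simp [glue, rotate, hy]
  simp [rotationRates, h]

theorem rotationRates_of_ne_singleton {Δ : Finset (Site d)} (h : ∀ x, Δ ≠ {x})
    (η : Site d → Fin q) (ξ : Δ → Fin q) : rotationRates α β q Δ η ξ = 0 := by
  simp [rotationRates, h]

theorem isContinuousRates_rotationRates (hα : (d : ℝ) < α)
    (hq : |β| * Real.pi * totalCoupling d α < q) :
    IsContinuousRates (rotationRates (d := d) α β q) := by
  intro Δ ξ
  by_cases hΔ : ∃ x, Δ = {x}
  · obtain ⟨x, rfl⟩ := hΔ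
    obtain ⟨M, g, -, hpos, -⟩ := exists_rotationRate_bounds hα hq x
    simp only [rotationRates_singleton]
    refine ⟨fun η => ?_, ?_⟩
    · split_ifs
      · exact (hpos η).1.le
      · exact le_rfl
    -- The target label depends on η only through the discrete label at x, so the case distinction
    -- is continuous.
    · have hk : Continuous fun p : Fin q × ℝ =>
          if ξ ⟨x, Finset.mem_singleton_self x⟩ = p.1 + 1 then p.2 else 0 := by
        refine continuous_prod_of_discrete_left.2 fun k => ?_
        by_cases h : ξ ⟨x, Finset.mem_singleton_self x⟩ = k + 1
        · simpa [h] using continuous_id'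
        · simpa [h] using continuous_const
      exact hk.comp ((continuous_apply x).prodMk (continuous_rotationRate hα hq x))
  · have hΔ' : ∀ x, Δ ≠ {x} := fun x h => hΔ ⟨x, h⟩
    simp only [rotationRates_of_ne_singleton hΔ']
    exact ⟨fun _ => le_rfl, continuous_const⟩

theorem isTranslationInvariant_rotationRates (hα : (d : ℝ) < α)
    (hq : |β| * Real.pi * totalCoupling d α < q) :
    IsTranslationInvariant (rotationRates (d := d) α β q) := by
  intro v Δ η ζ
  by_cases hΔ : ∃ x, Δ = {x}
  · obtain ⟨x, rfl⟩ := hΔ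
    have himg : ({x} : Finset (Site d)).image (· + v) = {x + v} := Finset.image_singleton _ _
    -- The type of the new labels depends on the volume, so the volume is generalised and the
    -- equality substituted instead of rewritten.
    have key : ∀ (Δ : Finset (Site d)) (_ : Δ = {x + v}),
        rotationRates α β q Δ (fun y => η (y - v)) (fun y => ζ (y.1 - v)) =
          rotationRates α β q {x} η (fun y => ζ y.1) := by
      rintro _ rfl
      rw [rotationRates_singleton, rotationRates_singleton, rotationRate_shift hα hq]
      simp
    convert key _ himg
  · have hΔ' : ∀ x, Δ ≠ {x} := fun x h => hΔ ⟨x, h⟩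
    rw [rotationRates_of_ne_singleton hΔ', rotationRates_of_ne_singleton]
    intro x h
    refine hΔ' (x - v) (Finset.image_injective (add_left_injective v) ?_)
    rw [Finset.image_singleton, sub_add_cancel]
    convert h

/-- Jumps take place in singletons, so the sums over volumes in (L1) and (L2) reduce to a single
term. -/
theorem tsum_volume_zero_eq (F : Finset (Site d) → ℝ≥0∞) (hF : ∀ Δ, (∀ x, Δ ≠ {x}) → F Δ = 0) :
    ∑' Δ : {Δ : Finset (Site d) // (0 : Site d) ∈ Δ}, F Δ.1 = F {0} := by
  rw [tsum_eq_single ⟨{0}, Finset.mem_singleton_self 0⟩]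
  intro Δ hΔ
  refine hF _ fun x hx => hΔ (Subtype.ext ?_)
  have h0 := Δ.2
  rw [hx, Finset.mem_singleton] at h0
  rw [hx, h0]

theorem boundedTotalRate_rotationRates (hα : (d : ℝ) < α)
    (hq : |β| * Real.pi * totalCoupling d α < q) :
    BoundedTotalRate (rotationRates (d := d) α β q) := by
  obtain ⟨M, g, -, hpos, -⟩ := exists_rotationRate_bounds hα hq (0 : Site d)
  rw [BoundedTotalRate, tsum_volume_zero_eq fun Δ => ∑ ξ : Δ → Fin q,
    supNorm fun η => rotationRates α β q Δ η ξ]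
  · refine ENNReal.sum_lt_top.2 fun ξ _ => ?_
    refine lt_of_le_of_lt (iSup_le fun η => ?_) (ENNReal.ofReal_lt_top (r := M))
    refine ENNReal.ofReal_le_ofReal ?_
    simp only [rotationRates_singleton]
    have h := hpos η
    split_ifs
    · rw [abs_of_pos h.1]
      exact h.2
    · simpa using h.1.le.trans h.2
  · intro Δ hΔ
    simp [rotationRates_of_ne_singleton hΔ, supNorm]

theorem summableOscillations_rotationRates (hα : (d : ℝ) < α)
    (hq : |β| * Real.pi * totalCoupling d α < q) :
    SummableOscillations (rotationRates (d := d) α β q) := by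
  obtain ⟨M, g, hg, -, hosc⟩ := exists_rotationRate_bounds hα hq (0 : Site d)
  rw [SummableOscillations, tsum_volume_zero_eq fun Δ => ∑' x : {x : Site d // x ≠ 0},
    ∑ ξ : Δ → Fin q, oscAt x.1 fun η => rotationRates α β q Δ η ξ]
  · rw [Summable.tsum_finsetSum fun _ _ => ENNReal.summable]
    refine ENNReal.sum_lt_top.2 fun ξ _ => ?_
    have hinj : Function.Injective fun z : {z : Site d // z ≠ 0} =>
        (⟨z.1, z.2⟩ : ({0}ᶜ : Set (Site d))) := fun a b h =>
      Subtype.ext (congrArg (fun y : ({0}ᶜ : Set (Site d)) => y.1) h)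
    refine lt_of_le_of_lt (ENNReal.tsum_le_tsum fun z => ?_)
      ((ENNReal.tsum_comp_le_tsum_of_injective hinj g).trans_lt hg.lt_top)
    refine iSup_le fun η => iSup_le fun ζ => iSup_le fun hag => ?_
    have h0 : η 0 = ζ 0 := hag 0 (Ne.symm z.2)
    simp only [rotationRates_singleton, ← h0]
    split_ifs
    · refine (hosc η ζ h0).trans ?_
      -- Only the label at z can differ, so the bound is the single weight g z, and these weights
      -- are summable over z.
      refine (ENNReal.tsum_mono_subtype (s := {y : ({0}ᶜ : Set (Site d)) | η y.1 ≠ ζ y.1})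
        (t := {⟨z.1, z.2⟩}) g fun y hy => Subtype.ext ?_).trans (tsum_singleton _ g).le
      by_contra h
      exact hy (hag y.1 h)
    · simp
  · intro Δ hΔ
    simp [rotationRates_of_ne_singleton hΔ, oscAt]

theorem positiveRate_rotate (hα : (d : ℝ) < α) (hq : |β| * Real.pi * totalCoupling d α < q)
    (x : Site d) (η : Site d → Fin q) :
    PositiveRate (rotationRates (d := d) α β q) η (rotate x η) := by
  obtain ⟨M, g, -, hpos, -⟩ := exists_rotationRate_bounds hα hq x
  refine ⟨{x}, fun y hy => ?_, ?_⟩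
  · rw [Finset.mem_singleton] at hy
    simp [rotate, hy]
  · rw [rotationRates_singleton, if_pos (by simp [rotate])]
    exact (hpos η).1

/-- Each rotation adds one modulo q, so the representative of `k - η x` counts the rotations needed.
-/
theorem reflTransGen_rotate (x : Site d) (k : Fin q) (η : Site d → Fin q) :
    Relation.ReflTransGen (fun η ζ : Site d → Fin q => ∃ x, ζ = rotate x η) η
      (Function.update η x k) := by
  have h : ∀ n : ℕ, Relation.ReflTransGen (fun η ζ : Site d → Fin q => ∃ x, ζ = rotate x η) η
      (Function.update η x (η x + Fin.ofNat q n)) := by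
    intro n
    induction n with
    | zero => simpa [Fin.ofNat] using Relation.ReflTransGen.refl
    | succ n ih =>
      refine ih.tail ⟨x, ?_⟩
      have hs : Fin.ofNat q (n + 1) = Fin.ofNat q n + 1 := by
        refine Fin.ext ?_
        rw [Fin.val_add, Fin.val_ofNat, Fin.val_ofNat, Fin.val_one', ← Nat.add_mod]
      rw [rotate, update_self, update_idem, hs, add_assoc]
  have := h (k - η x).1
  simpa using this

theorem reflTransGen_of_eq_off (Δ : Finset (Site d)) (η ξ : Site d → Fin q)
    (h : ∀ y, y ∉ Δ → η y = ξ y) :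
    Relation.ReflTransGen (fun η ζ : Site d → Fin q => ∃ x, ζ = rotate x η) η ξ := by
  induction Δ using Finset.induction generalizing η with
  | empty =>
    rw [show η = ξ from funext fun y => h y (Finset.notMem_empty y)]
  | insert x Δ hx ih =>
    refine (reflTransGen_rotate x (ξ x) η).trans (ih _ fun y hy => ?_)
    by_cases hyx : y = x
    · subst hyx
      simp
    · rw [update_of_ne hyx]
      exact h y (by simp [hyx, hy])

theorem exists_path_of_reflTransGen {Y : Type*} {r : Y → Y → Prop} {a b : Y}
    (h : Relation.ReflTransGen r a b) :
    ∃ (n : ℕ) (p : ℕ → Y), p 0 = a ∧ p n = b ∧ ∀ i, i < n → r (p i) (p (i + 1)) := by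
  induction h with
  | refl => exact ⟨0, fun _ => a, rfl, rfl, fun i hi => absurd hi (Nat.not_lt_zero i)⟩
  | @tail b c _ hbc ih =>
    obtain ⟨n, p, h0, hn, hp⟩ := ih
    refine ⟨n + 1, fun i => if i ≤ n then p i else c, by simpa using h0, by simp, fun i hi => ?_⟩
    rcases Nat.lt_succ_iff_lt_or_eq.1 hi with h | h
    · have h1 : i ≤ n := h.le
      have h2 : i + 1 ≤ n := h
      simpa [h1, h2] using hp i h
    · subst h
      simpa [hn] using hbc

theorem nonDegenerate_rotationRates (hα : (d : ℝ) < α)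
    (hq : |β| * Real.pi * totalCoupling d α < q) :
    NonDegenerate (rotationRates (d := d) α β q) := by
  intro Δ η ξ h
  obtain ⟨n, p, h0, hn, hp⟩ := exists_path_of_reflTransGen (reflTransGen_of_eq_off Δ η ξ h)
  refine ⟨n, p, h0, hn, fun i hi => ?_⟩
  obtain ⟨x, hx⟩ := hp i hi
  rw [hx]
  exact positiveRate_rotate hα hq x _

end Conclusions

end RotatingIPS

theorem mainTheorem7 (d : ℕ) (hd : d = 1 ∨ d = 2) (α : ℝ) (hα : (d : ℝ) < α ∧ α < 2 * d)
    (β : ℝ) (q : ℕ) [NeZero q]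
    (hq : |β| * Real.pi * ∑' x : {x : RotatingIPS.Site d // x ≠ 0},
      RotatingIPS.siteNorm x.1 ^ (-α) < q) :
    (∀ (x : RotatingIPS.Site d) (σ : RotatingIPS.DConfig q ({x}ᶜ : Set (RotatingIPS.Site d))),
      ∃! μ : MeasureTheory.Measure (RotatingIPS.Config ({x}ᶜ : Set (RotatingIPS.Site d))),
        RotatingIPS.IsConstrainedGibbs α β q σ μ) ∧
    RotatingIPS.IsContinuousRates (RotatingIPS.rotationRates (d := d) α β q) ∧
    RotatingIPS.IsTranslationInvariant (RotatingIPS.rotationRates (d := d) α β q) ∧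
    RotatingIPS.BoundedTotalRate (RotatingIPS.rotationRates (d := d) α β q) ∧
    RotatingIPS.SummableOscillations (RotatingIPS.rotationRates (d := d) α β q) ∧
    RotatingIPS.NonDegenerate (RotatingIPS.rotationRates (d := d) α β q) := by
  have hq' : |β| * Real.pi * RotatingIPS.totalCoupling d α < q := hq
  exact ⟨fun x σ => RotatingIPS.existsUnique_isConstrainedGibbs hα.1 hq' σ,
    RotatingIPS.isContinuousRates_rotationRates hα.1 hq',
    RotatingIPS.isTranslationInvariant_rotationRates hα.1 hq',
    RotatingIPS.boundedTotalRate_rotationRates hα.1 hq',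
    RotatingIPS.summableOscillations_rotationRates hα.1 hq',
    RotatingIPS.nonDegenerate_rotationRates hα.1 hq'⟩
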